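/- Let $n\ge 1$ candidates have non-negative valuations $\rho_i$ (receiver) and $\xi_i$ (sender) such that the pairs $(\rho_i,\xi_i)$, $i\in[n]$, are pairwise distinct, and let them arrive in uniformly random order, one per round. In round $t$ the sender observes the pair of the arriving candidate $\theta_t$ and sends a signal $\sigma_t\in\{\mathrm{HIRE},\mathrm{NOT}\}$. The receiver, who knows all pairs, the mechanism, and that the order is uniform, but sees only the signals so far (no disclosure), then irrevocably hires or rejects the candidate; hiring ends the process, and if nobody is hired both utilities are $0$. A (randomized) mechanism determines the distribution of $\sigma_t$ from the pairs observed up to round $t$ and the signals $\sigma_1,\dots,\sigma_{t-1}$. It is *persuasive* if in every round $t$ reached under obedience (that is, with $\sigma_1=\dots=\sigma_{t-1}=\mathrm{NOT}$), after each signal $\sigma_t$ of positive probability, obeying from then on (hire upon HIRE, reject upon NOT) maximizes the receiver's conditional expected utility, given the signals seen, among all continuation strategies. Let $\mathrm{OPT}$ be the supremum of the sender's expected utility (under obedience) over all persuasive mechanisms in the benchmark scenario, in which the sender knows all pairs in advance, so that the mechanism may depend on them. *Pareto procedure* on a finite nonempty set $A$ of pairs $(\rho,\xi)$: let $\mu$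 be the average of $\rho$ over $A$. If an element $c\in A$ of maximum $\xi$ has $\rho_c\ge\mu$, put $a=b=c$; otherwise choose $a,b\in A$ such that the segment $[a,b]$ lies in the Pareto frontier (the set of componentwise-maximal points) of the convex hull of $A$ and meets the line $\rho=\mu$ (where several choices are possible, by any fixed rule that depends only on the set $A$). Put $\alpha=1$ if $\rho_a=\rho_b$; $\alpha=0$ if $\rho_a\neq\rho_b$ and $\xi_a=\xi_b$; and $\alpha=\frac{\mu-\rho_b}{\rho_a-\rho_b}$ otherwise. Return $a$ with probability $\alpha$ and $b$ with probability $1-\alpha$. *Growing Pareto mechanism* with sample size $s$ (it does not know the pairs of candidates that have not arrived): signal NOT in rounds $t\le s$, $t<n$. In each round $s<t<n$ apply the Pareto procedure, with fresh randomness, to the set $A_t$ of the pairs of $\theta_1,\dots,\theta_t$, and signal HIRE if and only if it returns $\theta_t$. In round $n$ signal HIRE. After a HIRE signal, signal NOT in all later rounds. **Theorem.** There is a sequence $\varepsilon_n\to 0$, depending only on $n$, such that for every $n\ge1$, all valuations as above and every choice of the rule in the Pareto procedure, the Growing Pareto mechanism with $s=\lfloor n/\sqrt3\rfloor$ is persuasive,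 and its expected sender utility is at least $\left(\frac{1}{3\sqrt3}-\varepsilon_n\right)\mathrm{OPT}$. -/

import Mathlib

open Filter Topology

noncomputable section

open scoped Classical

namespace SecretaryPersuasion

/-- The order in which candidates arrive: `π t` is the candidate arriving in round `t`
(rounds are indexed from `0`). -/
abbrev Order (n : ℕ) := Equiv.Perm (Fin n)

/-- A (randomized) direct mechanism of the sender for `n` rounds. In round `t` it sees the
valuation pairs (receiver value, sender value) of the candidates of rounds `≤ t` and the signals
it sent in rounds `< t`, and signals HIRE with probability `hireProb t _ _` (otherwise NOT).
Signals are Booleans, `true` for HIRE and `false` for NOT. -/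
structure Mechanism (n : ℕ) where
  hireProb : (t : Fin n) → (Set.Iic t → ℝ × ℝ) → (Set.Iio t → Bool) → ℝ
  hireProb_nonneg : ∀ t x h, 0 ≤ hireProb t x h
  hireProb_le_one : ∀ t x h, hireProb t x h ≤ 1

/-- A strategy of the receiver without disclosure: in each round, provided that nobody has been
hired so far, decide (`true` = hire) on the basis of the signals of rounds `≤ t` only. -/
def ReceiverStrategy (n : ℕ) := (t : Fin n) → (Set.Iic t → Bool) → Bool

/-- Obedience: hire exactly upon the signal HIRE. -/
def obedient (n : ℕ) : ReceiverStrategy n := fun t h => h ⟨t, le_refl t⟩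

section Model

variable {n : ℕ}

/-- Probability that the mechanism, run through all rounds without interruption, sends the
signal vector `σ` when the candidates with valuations `(ρ i, ξ i)` arrive in the order `π`. -/
def signalProb (ρ ξ : Fin n → ℝ) (M : Mechanism n) (π : Order n) (σ : Fin n → Bool) : ℝ :=
  ∏ t : Fin n,
    if σ t = true then
      M.hireProb t (fun r => (ρ (π r.1), ξ (π r.1))) (fun r => σ r.1)
    else
      1 - M.hireProb t (fun r => (ρ (π r.1), ξ (π r.1))) (fun r => σ r.1)

/-- Expectation over the uniformly random arrival order and the random signals. -/
def expectation (ρ ξ : Fin n → ℝ) (M : Mechanism n) (F : Order n → (Fin n → Bool) → ℝ) : ℝ :=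
  (∑ π : Order n, ∑ σ : Fin n → Bool, signalProb ρ ξ M π σ * F π σ) / (n.factorial : ℝ)

/-- A receiver who has rejected everybody in the rounds before `k` and uses `d` from round `k` on
hires in round `r`. -/
def HiresAt (d : ReceiverStrategy n) (k : ℕ) (σ : Fin n → Bool) (r : Fin n) : Prop :=
  k ≤ (r : ℕ) ∧ d r (fun q => σ q.1) = true ∧
    ∀ q : Fin n, k ≤ (q : ℕ) → q < r → d q (fun j => σ j.1) = false

/-- The value, under the valuation `v`, of the candidate hired by a receiver who uses `d` from
round `k` on (`0` if nobody is hired). -/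
def hiredValue (v : Fin n → ℝ) (d : ReceiverStrategy n) (k : ℕ) (π : Order n)
    (σ : Fin n → Bool) : ℝ :=
  ∑ r : Fin n, if HiresAt d k σ r then v (π r) else 0

/-- The receiver's information in round `t` if nobody was hired before and she was obedient:
all earlier signals were NOT, and the current signal is `b`. -/
def Observed (t : Fin n) (b : Bool) (σ : Fin n → Bool) : Prop :=
  (∀ r : Fin n, r < t → σ r = false) ∧ σ t = b

/-- Persuasiveness for a receiver who knows all valuations, the mechanism, and that the arrival
order is uniform: in every round `t` reached under obedience, and for both signals `b`, obedience
from then on maximizes her conditional expected utility given the observed signals among all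
continuation strategies. Both sides are multiplied by the probability of the observation, so
that the condition is void exactly for observations of probability zero. -/
def Persuasive (ρ ξ : Fin n → ℝ) (M : Mechanism n) : Prop :=
  ∀ (t : Fin n) (b : Bool) (d : ReceiverStrategy n),
    expectation ρ ξ M (fun π σ => if Observed t b σ then hiredValue ρ d t π σ else 0) ≤
    expectation ρ ξ M
      (fun π σ => if Observed t b σ then hiredValue ρ (obedient n) t π σ else 0)

/-- The sender's expected utility when the receiver is obedient. -/
def senderUtility (ρ ξ : Fin n → ℝ) (M : Mechanism n) : ℝ :=
  expectation ρ ξ M (fun π σ => hiredValue ξ (obedient n) 0 π σ)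

/-- The sender utilities achievable in the basic scenario without disclosure, where the sender
knows the valuations, so that the persuasive mechanism `M` may be tailored to `ρ` and `ξ`. -/
def achievable (ρ ξ : Fin n → ℝ) : Set ℝ :=
  {u | ∃ M : Mechanism n, Persuasive ρ ξ M ∧ u = senderUtility ρ ξ M}

/-- The optimal expected sender utility in the basic scenario without disclosure. -/
def OPT (ρ ξ : Fin n → ℝ) : ℝ := sSup (achievable ρ ξ)

/-- The supremum defining `OPT` is taken over a bounded set. -/
theorem achievable_bddAbove (ρ ξ : Fin n → ℝ) (hξ : ∀ i, 0 ≤ ξ i) :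
    BddAbove (achievable ρ ξ) := by
  refine ⟨(∑ π : Order n, ∑ _σ : Fin n → Bool, ∑ r : Fin n, ξ (π r)) / (n.factorial : ℝ), ?_⟩
  rintro u ⟨M, -, rfl⟩
  unfold senderUtility expectation
  gcongr with π _ σ _
  have hv : hiredValue ξ (obedient n) 0 π σ ≤ ∑ r : Fin n, ξ (π r) := by
    unfold hiredValue
    gcongr with r _
    split_ifs
    · exact le_rfl
    · exact hξ _
  have h0 : 0 ≤ hiredValue ξ (obedient n) 0 π σ := by
    unfold hiredValue
    refine Finset.sum_nonneg fun r _ => ?_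
    split_ifs
    · exact hξ _
    · exact le_rfl
  have hp : signalProb ρ ξ M π σ ≤ 1 := by
    unfold signalProb
    refine Finset.prod_le_one (fun t _ => ?_) (fun t _ => ?_)
    · split_ifs
      · exact M.hireProb_nonneg _ _ _
      · exact sub_nonneg.2 (M.hireProb_le_one _ _ _)
    · split_ifs
      · exact M.hireProb_le_one _ _ _
      · exact sub_le_self _ (M.hireProb_nonneg _ _ _)
  exact (mul_le_of_le_one_left h0 hp).trans hv

end Model

/-! The Pareto procedure. A valuation pair is `(receiver value, sender value)`. -/

/-- The average receiver value of a finite set of valuation pairs. -/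
def avgReceiver (A : Finset (ℝ × ℝ)) : ℝ := (∑ p ∈ A, p.1) / (A.card : ℝ)

/-- The Pareto frontier of the convex hull (maximal points in the componentwise order). -/
def paretoFrontier (A : Finset (ℝ × ℝ)) : Set (ℝ × ℝ) :=
  {p | Maximal (fun q => q ∈ convexHull ℝ (A : Set (ℝ × ℝ))) p}

/-- `c` is a sender-optimal element of `A`. -/
def IsSenderBest (A : Finset (ℝ × ℝ)) (c : ℝ × ℝ) : Prop :=
  c ∈ A ∧ ∀ p ∈ A, p.2 ≤ c.2

/-- `(a, b)` is a pair as determined by the Pareto procedure: if a sender-optimal pair has at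
least average receiver value, it is such a pair, taken twice; otherwise `a` and `b` span a segment
of the Pareto frontier that meets the vertical line at the average receiver value. -/
def IsParetoPair (A : Finset (ℝ × ℝ)) (a b : ℝ × ℝ) : Prop :=
  a ∈ A ∧ b ∈ A ∧
    ((IsSenderBest A a ∧ avgReceiver A ≤ a.1 ∧ b = a) ∨
      ((∀ c, IsSenderBest A c → c.1 < avgReceiver A) ∧
        segment ℝ a b ⊆ paretoFrontier A ∧ ∃ p ∈ segment ℝ a b, p.1 = avgReceiver A))

/-- A rule, depending on the set `A` alone, by which the procedure finds its pair: it selects a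
pair as required whenever there is one. -/
def IsParetoRule (sel : Finset (ℝ × ℝ) → (ℝ × ℝ) × (ℝ × ℝ)) : Prop :=
  ∀ A : Finset (ℝ × ℝ), (∃ a b, IsParetoPair A a b) → IsParetoPair A (sel A).1 (sel A).2

/-- Such rules exist. -/
theorem exists_isParetoRule : ∃ sel, IsParetoRule sel :=
  ⟨fun A => Classical.epsilon fun ab => IsParetoPair A ab.1 ab.2, fun A ⟨a, b, h⟩ =>
    Classical.epsilon_spec (p := fun ab : (ℝ × ℝ) × (ℝ × ℝ) => IsParetoPair A ab.1 ab.2)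
      ⟨(a, b), h⟩⟩

/-- The parameter `α` of the procedure, applied to `A` with selected pair `(a, b)`. -/
def paretoAlpha (A : Finset (ℝ × ℝ)) (a b : ℝ × ℝ) : ℝ :=
  if a.1 = b.1 then 1
  else if a.2 = b.2 then 0
  else (avgReceiver A - b.1) / (a.1 - b.1)

/-- The probability that a uniform sample from `[0, 1]` is at most `α`. -/
def uniformCdf (α : ℝ) : ℝ := max 0 (min 1 α)

/-- The probability that the Pareto procedure, applied to `A`
with selected pair `(a, b)`, returns the pair `c`: it draws `x`
uniformly from `[0, 1]` and returns `a` if `x ≤ α` and `b` otherwise. -/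
def paretoProb (A : Finset (ℝ × ℝ)) (a b c : ℝ × ℝ) : ℝ :=
  (if c = a then uniformCdf (paretoAlpha A a b) else 0) +
    (if c = b then 1 - uniformCdf (paretoAlpha A a b) else 0)

theorem paretoProb_mem (A : Finset (ℝ × ℝ)) (a b c : ℝ × ℝ) :
    0 ≤ paretoProb A a b c ∧ paretoProb A a b c ≤ 1 := by
  have h0 : 0 ≤ uniformCdf (paretoAlpha A a b) := le_max_left _ _
  have h1 : uniformCdf (paretoAlpha A a b) ≤ 1 := max_le zero_le_one (min_le_left _ _)
  unfold paretoProb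
  constructor <;> split_ifs <;> linarith

/-- The Growing Pareto mechanism with sample size `s` and selection rule `sel`. It has no access to the valuations other
than those of the candidates that have arrived. The Fin-index `t` is round number `t + 1`, the
set `A` of valuation pairs seen so far is `Finset.univ.image x`, and each round uses fresh
randomness:
* after an earlier HIRE it signals NOT;
* otherwise, in the last round, it signals HIRE;
* otherwise, in the first `s` rounds, it signals NOT;
* otherwise it signals HIRE iff the Pareto procedure on `A` returns the current candidate. -/
def growingPareto (sel : Finset (ℝ × ℝ) → (ℝ × ℝ) × (ℝ × ℝ)) (n s : ℕ) : Mechanism n where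
  hireProb t x h :=
    if ∃ r, h r = true then 0
    else if (t : ℕ) + 1 = n then 1
    else if (t : ℕ) + 1 ≤ s then 0
    else paretoProb (Finset.univ.image x) (sel (Finset.univ.image x)).1
      (sel (Finset.univ.image x)).2 (x ⟨t, le_refl t⟩)
  hireProb_nonneg t x h := by
    split_ifs <;> first | exact (paretoProb_mem _ _ _ _).1 | norm_num
  hireProb_le_one t x h := by
    split_ifs <;> first | exact (paretoProb_mem _ _ _ _).2 | norm_num

end SecretaryPersuasion

end

/-! Write `m` for the average receiver value of all candidates and `V` for the sender value of the
expected pair (`paretoPoint`) of the Pareto procedure on all pairs.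

Upper bound (`OPT_le`). A persuasive mechanism gives the receiver at least `m`, since she could hire
the first arrival blindly. Its hiring probabilities, completed to a distribution, give a point of
the convex hull with receiver value at least `m`, and `V` is the largest sender value of such
points.

Exchangeability (`sum_prod_mul`). Count rounds from 0. Given the set of the first `r + 1` arrivals,
the latest is uniform in it. So for `s ≤ r < n - 1` the procedure returns it with probability `1 /
(r + 1)`, whatever the set and the later arrivals. Survival up to round `r` therefore has
probability `s / r` (for `s ≥ 1`) and is independent of the sample. The candidate hired there is
distributed as the procedure's outcome on a uniform sample.

Persuasiveness. A candidate with HIRE is worth at least `m` on average, a later one exactly `m`. The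
candidate of round `q` is worth `m` overall and at least `m` if the first HIRE comes by round `q`,
hence at most `m` if it comes later, while waiting then yields at least `m`.

Ratio. Let `a`, `b` be the pair for the full set. If a sample contains both and a share `w` of the
total shortfall `max (m - ρ i) 0`, its value is at least `w * V` (`exists_weights`). So the expected
sample value is at least `V` times the probability that `a`, `b` and a third candidate, drawn
according to shortfall, all lie in the sample. This is at least `C(r+1,3) / C(n,3)`. Weighting by `s
/ (r (r + 1))` and summing over `r` gives about `y (1 - y²) / 2` with `y = s / n`, which is maximal
at `y = 1 / √3` with value `1 / (3√3)`. -/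

namespace SecretaryPersuasion

/-! ### The Pareto procedure as a constrained optimum over the convex hull -/

section Pareto

variable {A : Finset (ℝ × ℝ)} {a b : ℝ × ℝ}

/-- The expected pair returned by the Pareto procedure. -/
noncomputable def paretoPoint (A : Finset (ℝ × ℝ)) (a b : ℝ × ℝ) : ℝ × ℝ :=
  uniformCdf (paretoAlpha A a b) • a + (1 - uniformCdf (paretoAlpha A a b)) • b

theorem uniformCdf_nonneg (α : ℝ) : 0 ≤ uniformCdf α := le_max_left _ _

theorem uniformCdf_le_one (α : ℝ) : uniformCdf α ≤ 1 := max_le zero_le_one (min_le_left _ _)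

theorem uniformCdf_of_mem {α : ℝ} (h0 : 0 ≤ α) (h1 : α ≤ 1) : uniformCdf α = α := by
  rw [uniformCdf, min_eq_right h1, max_eq_right h0]

theorem sum_paretoProb_mul (ha : a ∈ A) (hb : b ∈ A) (v : ℝ × ℝ → ℝ) :
    ∑ c ∈ A, paretoProb A a b c * v c =
      uniformCdf (paretoAlpha A a b) * v a + (1 - uniformCdf (paretoAlpha A a b)) * v b := by
  simp [paretoProb, add_mul, Finset.sum_add_distrib, ite_mul, ha, hb]

theorem sum_paretoProb (ha : a ∈ A) (hb : b ∈ A) : ∑ c ∈ A, paretoProb A a b c = 1 := by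
  simpa using sum_paretoProb_mul ha hb (fun _ => 1)

theorem sum_paretoProb_mul_fst (ha : a ∈ A) (hb : b ∈ A) :
    ∑ c ∈ A, paretoProb A a b c * c.1 = (paretoPoint A a b).1 := by
  simp [sum_paretoProb_mul ha hb, paretoPoint]

theorem sum_paretoProb_mul_snd (ha : a ∈ A) (hb : b ∈ A) :
    ∑ c ∈ A, paretoProb A a b c * c.2 = (paretoPoint A a b).2 := by
  simp [sum_paretoProb_mul ha hb, paretoPoint]

theorem paretoPoint_self (A : Finset (ℝ × ℝ)) (a : ℝ × ℝ) : paretoPoint A a a = a := by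
  rw [paretoPoint, ← add_smul]
  simp

/-- Endpoints sharing a coordinate are comparable, and comparable maximal points coincide. So on a
frontier segment the special cases of `paretoAlpha` arise only when `a = b`. -/
theorem eq_of_segment_subset_paretoFrontier (h : segment ℝ a b ⊆ paretoFrontier A)
    (hab : a.1 = b.1 ∨ a.2 = b.2) : a = b := by
  have ha : Maximal (fun q => q ∈ convexHull ℝ (A : Set (ℝ × ℝ))) a := h (left_mem_segment ℝ a b)
  have hb : Maximal (fun q => q ∈ convexHull ℝ (A : Set (ℝ × ℝ))) b := h (right_mem_segment ℝ a b)
  have key : a ≤ b ∨ b ≤ a := by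
    rcases hab with hab | hab
    · rcases le_total a.2 b.2 with h' | h'
      · exact Or.inl ⟨hab.le, h'⟩
      · exact Or.inr ⟨hab.ge, h'⟩
    · rcases le_total a.1 b.1 with h' | h'
      · exact Or.inl ⟨h', hab.le⟩
      · exact Or.inr ⟨h', hab.ge⟩
  rcases key with h' | h'
  · exact le_antisymm h' (ha.2 hb.1 h')
  · exact le_antisymm (hb.2 ha.1 h') h'

theorem paretoPoint_eq_of_mem_segment (h : segment ℝ a b ⊆ paretoFrontier A) {p : ℝ × ℝ}
    (hp : p ∈ segment ℝ a b) (hpA : p.1 = avgReceiver A) : paretoPoint A a b = p := by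
  by_cases hab : a.1 = b.1 ∨ a.2 = b.2
  · obtain rfl := eq_of_segment_subset_paretoFrontier h hab
    rw [paretoPoint_self]
    rw [segment_same] at hp
    exact hp.symm
  · push Not at hab
    obtain ⟨u, w, hu, hw, huw, rfl⟩ := hp
    obtain rfl : w = 1 - u := by linarith
    have hα : paretoAlpha A a b = u := by
      rw [paretoAlpha, if_neg hab.1, if_neg hab.2, ← hpA, div_eq_iff (sub_ne_zero.2 hab.1)]
      simp
      ring
    rw [paretoPoint, hα, uniformCdf_of_mem hu (by linarith)]

theorem IsParetoPair.avgReceiver_le (h : IsParetoPair A a b) :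
    avgReceiver A ≤ (paretoPoint A a b).1 := by
  obtain ⟨-, -, ⟨-, h2, rfl⟩ | ⟨-, hs, p, hp, hpA⟩⟩ := h
  · rwa [paretoPoint_self]
  · rw [paretoPoint_eq_of_mem_segment hs hp hpA, hpA]

/-- Optimality of the procedure. A sender-best element is optimal on the whole hull. Otherwise the
expected pair is a frontier point with receiver value exactly the average, and a better `q` would
dominate it. -/
theorem IsParetoPair.snd_le (h : IsParetoPair A a b) {q : ℝ × ℝ}
    (hq : q ∈ convexHull ℝ (A : Set (ℝ × ℝ))) (hqA : avgReceiver A ≤ q.1) :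
    q.2 ≤ (paretoPoint A a b).2 := by
  obtain ⟨-, -, ⟨h1, h2, rfl⟩ | ⟨-, hs, p, hp, hpA⟩⟩ := h
  · rw [paretoPoint_self]
    have hc : Convex ℝ {x : ℝ × ℝ | x.2 ≤ b.2} :=
      convex_halfSpace_le (LinearMap.snd ℝ ℝ ℝ).isLinear b.2
    exact convexHull_min (fun x hx => h1.2 x hx) hc hq
  · rw [paretoPoint_eq_of_mem_segment hs hp hpA]
    by_contra! hlt
    have hm : Maximal (fun q => q ∈ convexHull ℝ (A : Set (ℝ × ℝ))) p := hs hp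
    exact absurd (hm.2 hq ⟨hpA.le.trans hqA, hlt.le⟩).2 (not_le.2 hlt)

/-- The segment lies on a supporting line of the hull whose normal has two positive coordinates, so
nothing on or below that line dominates its points. -/
theorem segment_subset_paretoFrontier {l v : ℝ} (hl : 0 < l) (ha : a ∈ A) (hb : b ∈ A)
    (hle : ∀ p ∈ A, p.2 + l * p.1 ≤ v) (hav : a.2 + l * a.1 = v) (hbv : b.2 + l * b.1 = v) :
    segment ℝ a b ⊆ paretoFrontier A := by
  intro p hp
  have hpA : p ∈ convexHull ℝ (A : Set (ℝ × ℝ)) := segment_subset_convexHull ha hb hp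
  have hle' : ∀ q ∈ convexHull ℝ (A : Set (ℝ × ℝ)), q.2 + l * q.1 ≤ v := by
    have hc : Convex ℝ {x : ℝ × ℝ | (LinearMap.snd ℝ ℝ ℝ + l • LinearMap.fst ℝ ℝ ℝ) x ≤ v} :=
      convex_halfSpace_le (LinearMap.isLinear _) v
    intro q hq
    have := convexHull_min (fun x hx => by simpa using hle x hx) hc hq
    simpa using this
  have hpv : p.2 + l * p.1 = v := by
    obtain ⟨u, w, hu, hw, huw, rfl⟩ := hp
    simp only [Prod.snd_add, Prod.smul_snd, Prod.fst_add, Prod.smul_fst, smul_eq_mul]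
    linear_combination u * hav + w * hbv + v * huw
  refine ⟨hpA, fun q hq hpq => ?_⟩
  have h1 := hle' q hq
  have h2 := hpq.1
  have h3 := hpq.2
  have h4 : l * p.1 ≤ l * q.1 := mul_le_mul_of_nonneg_left h2 hl.le
  have h5 : q.1 = p.1 := by
    by_contra hne
    have : l * p.1 < l * q.1 := mul_lt_mul_of_pos_left (lt_of_le_of_ne h2 (Ne.symm hne)) hl
    linarith
  exact ⟨h5.le, by linarith⟩

theorem exists_avgReceiver_le (hA : A.Nonempty) : ∃ p ∈ A, avgReceiver A ≤ p.1 := by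
  obtain ⟨p, hp, hle⟩ := Finset.exists_le_of_sum_le (s := A) (f := fun _ => avgReceiver A)
    (g := fun p => p.1) hA (by
      have : (A.card : ℝ) ≠ 0 := by exact_mod_cast hA.card_pos.ne'
      rw [Finset.sum_const, nsmul_eq_mul, avgReceiver, mul_div_cancel₀ _ this])
  exact ⟨p, hp, hle⟩

/-- Lagrange multiplier argument: `h l` and `k l` are the maxima of `p.2 + l * (p.1 - m)` to the
left and to the right of the line `p.1 = m`. At a crossing `h l = k l` the two maximizers span a
supporting segment that meets the line. -/
theorem exists_isParetoPair (hA : A.Nonempty) : ∃ a b, IsParetoPair A a b := by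
  by_cases hc : ∃ c, IsSenderBest A c ∧ avgReceiver A ≤ c.1
  · obtain ⟨c, h1, h2⟩ := hc
    exact ⟨c, c, h1.1, h1.1, Or.inl ⟨h1, h2, rfl⟩⟩
  push Not at hc
  set m := avgReceiver A with hm
  obtain ⟨c, hcA, hcmax⟩ := A.exists_max_image (fun p => p.2) hA
  obtain ⟨d, hdA, hd⟩ := exists_avgReceiver_le hA
  have hL : (A.filter fun p => p.1 < m).Nonempty :=
    ⟨c, Finset.mem_filter.2 ⟨hcA, hc c ⟨hcA, hcmax⟩⟩⟩
  have hR : (A.filter fun p => m ≤ p.1).Nonempty := ⟨d, Finset.mem_filter.2 ⟨hdA, hd⟩⟩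
  let h : ℝ → ℝ := fun l => (A.filter fun p => p.1 < m).sup' hL fun p => p.2 + l * (p.1 - m)
  let k : ℝ → ℝ := fun l => (A.filter fun p => m ≤ p.1).sup' hR fun p => p.2 + l * (p.1 - m)
  have hh : Continuous h := by
    refine Continuous.finset_sup'_apply hL fun p _ => ?_
    fun_prop
  have hk : Continuous k := by
    refine Continuous.finset_sup'_apply hR fun p _ => ?_
    fun_prop
  -- At `l = 0` the left side wins, since every sender-best element lies there. This strictness
  -- later forces `0 < l`.
  have h0 : k 0 < h 0 := by
    obtain ⟨e, he, hke⟩ := Finset.exists_mem_eq_sup' hR (fun p : ℝ × ℝ => p.2 + 0 * (p.1 - m))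
    have he' := Finset.mem_filter.1 he
    have h1 : c.2 + 0 * (c.1 - m) ≤ h 0 :=
      Finset.le_sup' (fun p : ℝ × ℝ => p.2 + 0 * (p.1 - m))
        (Finset.mem_filter.2 ⟨hcA, hc c ⟨hcA, hcmax⟩⟩)
    have h2 : k 0 = e.2 + 0 * (e.1 - m) := hke
    have h3 : e.2 < c.2 := by
      refine lt_of_le_of_ne (hcmax e he'.1) fun heq => ?_
      exact absurd he'.2 (not_le.2 (hc e ⟨he'.1, fun p hp => heq ▸ hcmax p hp⟩))
    linarith
  have hev : ∀ᶠ l in atTop, h l ≤ d.2 := by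
    have : ∀ p ∈ A.filter (fun p => p.1 < m), ∀ᶠ l : ℝ in atTop, p.2 + l * (p.1 - m) ≤ d.2 := by
      intro p hp
      have hp' := (Finset.mem_filter.1 hp).2
      have ht : Tendsto (fun l : ℝ => p.2 + l * (p.1 - m)) atTop atBot :=
        tendsto_atBot_add_const_left _ _
          (tendsto_id.atTop_mul_const_of_neg (sub_neg.2 hp'))
      exact ht.eventually (eventually_le_atBot _)
    filter_upwards [(Finset.eventually_all _).2 this] with l hl
    exact Finset.sup'_le _ _ hl
  obtain ⟨l1, hl1, hl1pos⟩ := (hev.and (eventually_gt_atTop (0 : ℝ))).exists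
  have h1 : h l1 ≤ k l1 := by
    have : d.2 + l1 * (d.1 - m) ≤ k l1 :=
      Finset.le_sup' (fun p : ℝ × ℝ => p.2 + l1 * (p.1 - m)) (Finset.mem_filter.2 ⟨hdA, hd⟩)
    have : 0 ≤ l1 * (d.1 - m) := mul_nonneg hl1pos.le (sub_nonneg.2 hd)
    linarith
  obtain ⟨l, hl, hleq⟩ : ∃ l ∈ Set.Icc 0 l1, h l - k l = 0 := by
    have := intermediate_value_Icc' hl1pos.le ((hh.sub hk).continuousOn (s := Set.Icc 0 l1))
    exact this ⟨by simpa using h1, by simpa using h0.le⟩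
  have hlpos : 0 < l := by
    refine lt_of_le_of_ne hl.1 fun he => ?_
    rw [← he] at hleq
    linarith
  obtain ⟨a, ha, hha⟩ := Finset.exists_mem_eq_sup' hL (fun p : ℝ × ℝ => p.2 + l * (p.1 - m))
  obtain ⟨b, hb, hkb⟩ := Finset.exists_mem_eq_sup' hR (fun p : ℝ × ℝ => p.2 + l * (p.1 - m))
  have hha : h l = a.2 + l * (a.1 - m) := hha
  have hkb : k l = b.2 + l * (b.1 - m) := hkb
  have ha' := Finset.mem_filter.1 ha
  have hb' := Finset.mem_filter.1 hb
  have hle : ∀ p ∈ A, p.2 + l * p.1 ≤ h l + l * m := by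
    intro p hp
    rcases lt_or_ge p.1 m with hpm | hpm
    · have : p.2 + l * (p.1 - m) ≤ h l :=
        Finset.le_sup' (fun p : ℝ × ℝ => p.2 + l * (p.1 - m)) (Finset.mem_filter.2 ⟨hp, hpm⟩)
      linarith
    · have : p.2 + l * (p.1 - m) ≤ k l :=
        Finset.le_sup' (fun p : ℝ × ℝ => p.2 + l * (p.1 - m)) (Finset.mem_filter.2 ⟨hp, hpm⟩)
      linarith
  refine ⟨a, b, ha'.1, hb'.1, Or.inr ⟨hc, ?_, ?_⟩⟩
  · exact segment_subset_paretoFrontier hlpos ha'.1 hb'.1 hle (by linarith) (by linarith)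
  · have hlt : a.1 < b.1 := ha'.2.trans_le hb'.2
    have hpos : 0 < b.1 - a.1 := sub_pos.2 hlt
    refine ⟨((b.1 - m) / (b.1 - a.1)) • a + ((m - a.1) / (b.1 - a.1)) • b,
      ⟨_, _, div_nonneg (sub_nonneg.2 hb'.2) hpos.le,
        div_nonneg (sub_nonneg.2 ha'.2.le) hpos.le, ?_, rfl⟩, ?_⟩
    · field_simp
      ring
    · simp only [Prod.fst_add, Prod.smul_fst, smul_eq_mul]
      field_simp
      ring

end Pareto

/-! ### Only signal vectors with exactly one HIRE have positive probability -/

section Signals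

open scoped Classical

variable {n : ℕ}

/-- The pairs of the candidates that arrive in the rounds up to `t`. -/
noncomputable def seen (x : Fin n → ℝ × ℝ) (π : Order n) (t : Fin n) : Finset (ℝ × ℝ) :=
  (Finset.Iic t).image fun j => x (π j)

/-- The probability of HIRE in round `t` of the Growing Pareto mechanism after NOT signals. -/
noncomputable def roundProb (sel : Finset (ℝ × ℝ) → (ℝ × ℝ) × (ℝ × ℝ)) (s : ℕ)
    (x : Fin n → ℝ × ℝ) (π : Order n) (t : Fin n) : ℝ :=
  if (t : ℕ) + 1 = n then 1
  else if (t : ℕ) + 1 ≤ s then 0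
  else paretoProb (seen x π t) (sel (seen x π t)).1 (sel (seen x π t)).2 (x (π t))

/-- The signal vector whose only HIRE signal is in round `r`. -/
def hireOnly (r : Fin n) : Fin n → Bool := fun t => decide (t = r)

theorem hireOnly_injective : Function.Injective (hireOnly (n := n)) := by
  intro r r' h
  have := congrFun h r
  simpa [hireOnly] using this

/-- The probability that the first HIRE signal comes in round `r`. -/
noncomputable def hireWeight (sel : Finset (ℝ × ℝ) → (ℝ × ℝ) × (ℝ × ℝ)) (s : ℕ)
    (x : Fin n → ℝ × ℝ) (π : Order n) (r : Fin n) : ℝ :=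
  (∏ q ∈ Finset.Iio r, (1 - roundProb sel s x π q)) * roundProb sel s x π r

variable (sel : Finset (ℝ × ℝ) → (ℝ × ℝ) × (ℝ × ℝ)) (s : ℕ) (ρ ξ : Fin n → ℝ) (π : Order n)

theorem hireProb_growingPareto (σ : Fin n → Bool) (t : Fin n) :
    (growingPareto sel n s).hireProb t (fun r => (ρ (π r.1), ξ (π r.1))) (fun r => σ r.1) =
      if ∃ r, r < t ∧ σ r = true then 0
      else roundProb sel s (fun i => (ρ i, ξ i)) π t := by
  have himg : (Finset.univ.image fun r : Set.Iic t => (ρ (π r.1), ξ (π r.1))) =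
      seen (fun i => (ρ i, ξ i)) π t := by
    ext c
    simp [seen]
  have hex : (∃ r : Set.Iio t, σ r.1 = true) ↔ ∃ r, r < t ∧ σ r = true := by
    simp
  simp only [growingPareto, himg, hex, roundProb]

theorem signalProb_hireOnly (r : Fin n) :
    signalProb ρ ξ (growingPareto sel n s) π (hireOnly r) =
      hireWeight sel s (fun i => (ρ i, ξ i)) π r := by
  have hex : ∀ t : Fin n, (∃ q, q < t ∧ hireOnly r q = true) ↔ r < t := by
    simp [hireOnly]
  have hf : ∀ t : Fin n,
      (if hireOnly r t = true then
        (growingPareto sel n s).hireProb t (fun q => (ρ (π q.1), ξ (π q.1)))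
          (fun q => hireOnly r q.1)
      else 1 - (growingPareto sel n s).hireProb t (fun q => (ρ (π q.1), ξ (π q.1)))
          (fun q => hireOnly r q.1)) =
      (if t ∈ Finset.Iio r then 1 - roundProb sel s (fun i => (ρ i, ξ i)) π t else 1) *
        (if t = r then roundProb sel s (fun i => (ρ i, ξ i)) π t else 1) := by
    intro t
    rw [hireProb_growingPareto]
    simp only [hex, Finset.mem_Iio]
    rcases lt_trichotomy t r with h | rfl | h
    · simp [hireOnly, h, h.ne, h.not_gt]
    · simp [hireOnly]
    · simp [hireOnly, h, h.ne', h.not_gt]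
  rw [signalProb, Finset.prod_congr rfl fun t _ => hf t, Finset.prod_mul_distrib,
    Finset.prod_ite_mem, Finset.univ_inter, Finset.prod_ite_eq' Finset.univ r,
    if_pos (Finset.mem_univ r), hireWeight]

/-- Without any HIRE the factor of the last round vanishes, as HIRE is then certain; with two HIREs
the factor of a later one vanishes. -/
theorem signalProb_eq_zero (hn : 1 ≤ n) {σ : Fin n → Bool} (hσ : ∀ r, σ ≠ hireOnly r) :
    signalProb ρ ξ (growingPareto sel n s) π σ = 0 := by
  rw [signalProb]
  by_cases hall : ∀ t, σ t = false
  · refine Finset.prod_eq_zero (Finset.mem_univ (⟨n - 1, by omega⟩ : Fin n)) ?_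
    rw [hireProb_growingPareto]
    simp [hall, roundProb, Nat.sub_add_cancel hn]
  · push Not at hall
    obtain ⟨t, ht⟩ := hall
    have hne : (Finset.univ.filter fun t => σ t = true).Nonempty := ⟨t, by simpa using ht⟩
    obtain ⟨r, hr, hmin⟩ := Finset.exists_min_image _ id hne
    have hr' : σ r = true := by simpa using hr
    obtain ⟨q, hq⟩ : ∃ q, σ q ≠ hireOnly r q := Function.ne_iff.1 (hσ r)
    have hqr : q ≠ r := by
      rintro rfl
      simp [hireOnly, hr'] at hq
    have hqt : σ q = true := by simpa [hireOnly, hqr] using hq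
    have hlt : r < q := lt_of_le_of_ne (hmin q (by simpa using hqt)) (Ne.symm hqr)
    refine Finset.prod_eq_zero (Finset.mem_univ q) ?_
    rw [hireProb_growingPareto, if_pos hqt, if_pos ⟨r, hlt, hr'⟩]

theorem expectation_growingPareto (hn : 1 ≤ n) (F : Order n → (Fin n → Bool) → ℝ) :
    expectation ρ ξ (growingPareto sel n s) F =
      (∑ r, ∑ π : Order n, hireWeight sel s (fun i => (ρ i, ξ i)) π r * F π (hireOnly r)) /
        (n.factorial : ℝ) := by
  rw [expectation, Finset.sum_comm (s := (Finset.univ : Finset (Fin n)))]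
  congr 1
  refine Finset.sum_congr rfl fun π _ => ?_
  rw [← Finset.sum_subset (Finset.subset_univ (Finset.univ.image (hireOnly (n := n))))]
  · rw [Finset.sum_image fun _ _ _ _ h => hireOnly_injective h]
    exact Finset.sum_congr rfl fun r _ => by rw [signalProb_hireOnly]
  · intro σ _ hσ
    rw [signalProb_eq_zero sel s ρ ξ π hn, zero_mul]
    rintro r rfl
    exact hσ (Finset.mem_image_of_mem _ (Finset.mem_univ r))

end Signals

/-! ### Signal probabilities sum to one -/

section TotalProbability

variable {n : ℕ}

/-- Signalling in each round with a probability that depends on earlier signals only gives total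
probability one. -/
theorem sum_prod_signals (f : Fin n → (Fin n → Bool) → ℝ)
    (hf : ∀ t σ τ, (∀ r, r < t → σ r = τ r) → f t σ = f t τ) :
    ∑ σ : Fin n → Bool, ∏ t, (if σ t = true then f t σ else 1 - f t σ) = 1 := by
  -- The product over the first `k` rounds sums to `2 ^ (n - k)`, the later signals being free.
  -- Flipping signal `k` turns its factor `w` into `1 - w` and keeps the earlier ones, so each new
  -- round halves the sum.
  have key : ∀ k ≤ n, 2 ^ k * ∑ σ : Fin n → Bool,
      ∏ t ∈ Finset.univ.filter (fun t : Fin n => (t : ℕ) < k),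
        (if σ t = true then f t σ else 1 - f t σ) = 2 ^ n := by
    intro k
    induction k with
    | zero => simp
    | succ k ih =>
      intro hk
      let t : Fin n := ⟨k, hk⟩
      have hfil : Finset.univ.filter (fun q : Fin n => (q : ℕ) < k + 1) =
          insert t (Finset.univ.filter fun q : Fin n => (q : ℕ) < k) := by
        ext q
        simp [t, Fin.ext_iff]
        omega
      have hnot : t ∉ Finset.univ.filter fun q : Fin n => (q : ℕ) < k := by simp [t]
      let flip : (Fin n → Bool) → (Fin n → Bool) := fun σ => Function.update σ t (!σ t)
      have hinv : Function.Involutive flip := by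
        intro σ
        simp [flip]
      have hlt : ∀ (σ : Fin n → Bool) (q : Fin n), q < t → flip σ q = σ q := fun σ q hq =>
        Function.update_of_ne hq.ne _ _
      rw [hfil]
      simp only [Finset.prod_insert hnot]
      let w : (Fin n → Bool) → ℝ := fun σ => if σ t = true then f t σ else 1 - f t σ
      let P : (Fin n → Bool) → ℝ := fun σ =>
        ∏ q ∈ Finset.univ.filter (fun q : Fin n => (q : ℕ) < k),
          (if σ q = true then f q σ else 1 - f q σ)
      have hadd : ∀ σ : Fin n → Bool, w (flip σ) = 1 - w σ := by
        intro σ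
        have h1 : flip σ t = !σ t := Function.update_self _ _ _
        simp only [w]
        rw [hf t (flip σ) σ (hlt σ), h1]
        by_cases h : σ t = true <;> simp [h]
      have hprod : ∀ σ : Fin n → Bool, P (flip σ) = P σ := by
        intro σ
        refine Finset.prod_congr rfl fun q hq => ?_
        have hq' : q < t := Fin.lt_def.2 (Finset.mem_filter.1 hq).2
        rw [hlt σ q hq', hf q (flip σ) σ fun r hr => hlt σ r (hr.trans hq')]
      have hsum : ∑ σ, (1 - w σ) * P σ = ∑ σ, w σ * P σ :=
        Fintype.sum_equiv hinv.toPerm _ _ fun σ => by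
          rw [← hadd σ, ← hprod σ, Function.Involutive.coe_toPerm]
      simp only [sub_mul, one_mul, Finset.sum_sub_distrib] at hsum
      change 2 ^ (k + 1) * ∑ σ, w σ * P σ = 2 ^ n
      have ih' : 2 ^ k * ∑ σ, P σ = 2 ^ n := ih (by omega)
      rw [pow_succ]
      linear_combination ih' - 2 ^ k * hsum
  have h := key n le_rfl
  have hfil : Finset.univ.filter (fun t : Fin n => (t : ℕ) < n) = Finset.univ := by
    ext t
    simp
  rw [hfil] at h
  exact mul_left_cancel₀ (pow_ne_zero n two_ne_zero) (h.trans (mul_one _).symm)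

theorem sum_signalProb (ρ ξ : Fin n → ℝ) (M : Mechanism n) (π : Order n) :
    ∑ σ, signalProb ρ ξ M π σ = 1 := by
  refine sum_prod_signals
    (fun t σ => M.hireProb t (fun r => (ρ (π r.1), ξ (π r.1))) (fun r => σ r.1)) ?_
  intro t σ τ h
  have : (fun r : Set.Iio t => σ r.1) = fun r => τ r.1 := funext fun r => h r.1 r.2
  simp only [this]

theorem signalProb_nonneg (ρ ξ : Fin n → ℝ) (M : Mechanism n) (π : Order n) (σ : Fin n → Bool) :
    0 ≤ signalProb ρ ξ M π σ := by
  refine Finset.prod_nonneg fun t _ => ?_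
  split_ifs
  · exact M.hireProb_nonneg _ _ _
  · exact sub_nonneg.2 (M.hireProb_le_one _ _ _)

end TotalProbability

/-! ### Exchangeability of the arrival order -/

section Exchangeability

open scoped Classical

variable {n : ℕ}

/-- `F` depends on the candidates of the rounds before `k` only through their set. -/
def InvariantBefore (k : ℕ) (F : Order n → ℝ) : Prop :=
  ∀ π τ : Order n, (∀ j : Fin n, k ≤ (j : ℕ) → τ j = j) → F (π * τ) = F π

theorem InvariantBefore.mono {k l : ℕ} {F : Order n → ℝ} (h : InvariantBefore l F) (hkl : k ≤ l) :
    InvariantBefore k F := fun π τ hτ => h π τ fun j hj => hτ j (hkl.trans hj)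

theorem InvariantBefore.mul {k : ℕ} {F G : Order n → ℝ} (hF : InvariantBefore k F)
    (hG : InvariantBefore k G) : InvariantBefore k fun π => F π * G π := fun π τ hτ => by
  simp only [hF π τ hτ, hG π τ hτ]

theorem invariantBefore_apply (v : Fin n → ℝ) {k : ℕ} {j : Fin n} (hj : k ≤ (j : ℕ)) :
    InvariantBefore k fun π : Order n => v (π j) := fun π τ hτ => by
  simp only [Equiv.Perm.mul_apply, hτ j hj]

theorem seen_mul (x : Fin n → ℝ × ℝ) (π τ : Order n) (t : Fin n)
    (hτ : ∀ j : Fin n, (t : ℕ) + 1 ≤ (j : ℕ) → τ j = j) : seen x (π * τ) t = seen x π t := by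
  have hfix : ∀ j : Fin n, t < j → τ j = j := fun j hj => hτ j hj
  have hmap : (Finset.Iic t).image τ = Finset.Iic t := by
    refine Finset.eq_of_subset_of_card_le ?_ ?_
    · intro i hi
      obtain ⟨j, hj, rfl⟩ := Finset.mem_image.1 hi
      rw [Finset.mem_Iic] at hj ⊢
      by_contra! hlt
      have := τ.injective (hfix _ hlt)
      rw [this] at hlt
      exact absurd hj (not_le.2 hlt)
    · rw [Finset.card_image_of_injective _ τ.injective]
  calc seen x (π * τ) t = ((Finset.Iic t).image τ).image fun j => x (π j) := by
        rw [Finset.image_image]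
        rfl
    _ = seen x π t := by
        rw [hmap]
        rfl

variable (sel : Finset (ℝ × ℝ) → (ℝ × ℝ) × (ℝ × ℝ)) (s : ℕ) {x : Fin n → ℝ × ℝ}

theorem invariantBefore_roundProb (t : Fin n) :
    InvariantBefore (t : ℕ) fun π => roundProb sel s x π t := fun π τ hτ => by
  simp only [roundProb, seen_mul x π τ t fun j hj => hτ j (by omega), Equiv.Perm.mul_apply,
    hτ t le_rfl]

/-- The selection in a nontrivial round of the mechanism: by exchangeability, the current
candidate is a uniformly random element of the set of those seen. -/
theorem sum_mul_roundProb_mul (hx : Function.Injective x) {t : Fin n} (hs : s ≤ (t : ℕ))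
    (ht : (t : ℕ) + 1 < n) {F : Order n → ℝ} (hF : InvariantBefore ((t : ℕ) + 1) F)
    (v : ℝ × ℝ → ℝ) :
    ((t : ℝ) + 1) * ∑ π, F π * (roundProb sel s x π t * v (x (π t))) =
      ∑ π, F π * ∑ c ∈ seen x π t,
        paretoProb (seen x π t) (sel (seen x π t)).1 (sel (seen x π t)).2 c * v c := by
  -- Swapping rounds `j ≤ t` and `t` preserves the uniform order, the seen set and `F`. Summing over
  -- all `j ≤ t` then runs through the whole seen set.
  have h1 : ∀ j ∈ Finset.Iic t, ∑ π, F π * (roundProb sel s x π t * v (x (π t))) =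
      ∑ π, F π * (paretoProb (seen x π t) (sel (seen x π t)).1 (sel (seen x π t)).2 (x (π j)) *
        v (x (π j))) := by
    intro j hj
    have hj' := Finset.mem_Iic.1 hj
    rw [← Equiv.sum_comp (Equiv.mulRight (Equiv.swap j t))]
    refine Finset.sum_congr rfl fun π _ => ?_
    have hτ : ∀ i : Fin n, (t : ℕ) + 1 ≤ (i : ℕ) → Equiv.swap j t i = i := by
      intro i hi
      have hlt : t < i := hi
      exact Equiv.swap_apply_of_ne_of_ne (hj'.trans_lt hlt).ne' hlt.ne'
    rw [Equiv.coe_mulRight, hF _ _ hτ, roundProb, if_neg ht.ne, if_neg (by omega),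
      seen_mul x π _ t hτ, Equiv.Perm.mul_apply, Equiv.swap_apply_right]
  have h2 : ((t : ℝ) + 1) = ((Finset.Iic t).card : ℝ) := by
    rw [Fin.card_Iic]
    push_cast
    rfl
  rw [h2, ← nsmul_eq_mul, ← Finset.sum_const, Finset.sum_congr rfl h1, Finset.sum_comm]
  refine Finset.sum_congr rfl fun π _ => ?_
  rw [← Finset.mul_sum]
  congr 1
  conv_rhs =>
    rw [seen]
  rw [Finset.sum_image fun i _ j _ h => π.injective (hx h)]
  rfl

theorem seen_nonempty (x : Fin n → ℝ × ℝ) (π : Order n) (t : Fin n) : (seen x π t).Nonempty :=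
  Finset.nonempty_Iic.image _

variable {sel}

theorem IsParetoRule.isParetoPair (hsel : IsParetoRule sel) {A : Finset (ℝ × ℝ)}
    (hA : A.Nonempty) : IsParetoPair A (sel A).1 (sel A).2 := hsel A (exists_isParetoPair hA)

/-- The procedure always returns some seen element, so by symmetry it returns the current one with
probability `1 / (t + 1)`, independently of any `F` that sees only the set and the later arrivals.
-/
theorem sum_mul_roundProb (hsel : IsParetoRule sel) (hx : Function.Injective x) {t : Fin n}
    (hs : s ≤ (t : ℕ)) (ht : (t : ℕ) + 1 < n) {F : Order n → ℝ}
    (hF : InvariantBefore ((t : ℕ) + 1) F) :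
    ((t : ℝ) + 1) * ∑ π, F π * roundProb sel s x π t = ∑ π, F π := by
  have h := sum_mul_roundProb_mul sel s hx hs ht hF fun _ => 1
  simp only [mul_one] at h
  rw [h]
  refine Finset.sum_congr rfl fun π _ => ?_
  have hp := hsel.isParetoPair (seen_nonempty x π t)
  rw [sum_paretoProb hp.1 hp.2.1, mul_one]

/-- The probability of signalling NOT in all rounds before `k`. -/
noncomputable def survival (s k : ℕ) : ℝ := if k ≤ s then 1 else (s : ℝ) / k

theorem survival_of_le {s k : ℕ} (hs : 1 ≤ s) (h : s ≤ k) : survival s k = (s : ℝ) / k := by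
  rcases h.eq_or_lt with rfl | h
  · rw [survival, if_pos le_rfl, div_self (by exact_mod_cast (by omega : s ≠ 0))]
  · rw [survival, if_neg (not_le.2 h)]

theorem survival_nonneg (s k : ℕ) : 0 ≤ survival s k := by
  unfold survival
  split_ifs <;> positivity

/-- The event that all signals before round `k` are NOT is independent of the set of candidates
seen before round `k` and of all later arrivals. -/
theorem sum_prod_mul (hsel : IsParetoRule sel) (hx : Function.Injective x) :
    ∀ (k : ℕ) (hk : k < n) (F : Order n → ℝ), InvariantBefore k F →
      ∑ π, (∏ q ∈ Finset.Iio (⟨k, hk⟩ : Fin n), (1 - roundProb sel s x π q)) * F π =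
        survival s k * ∑ π, F π := by
  intro k
  induction k with
  | zero =>
    intro hk F _
    have : Finset.Iio (⟨0, hk⟩ : Fin n) = ∅ := by
      ext q
      simp [Fin.lt_def]
    simp [this, survival]
  | succ k ih =>
    intro hk F hF
    let t : Fin n := ⟨k, by omega⟩
    have hins : Finset.Iio (⟨k + 1, hk⟩ : Fin n) = insert t (Finset.Iio t) := by
      ext q
      simp only [Finset.mem_Iio, Finset.mem_insert, Fin.lt_def, Fin.ext_iff, t]
      omega
    have hnot : t ∉ Finset.Iio t := by simp
    have hinv : InvariantBefore k fun π => (1 - roundProb sel s x π t) * F π := by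
      intro π τ hτ
      have h1 := invariantBefore_roundProb (x := x) sel s t π τ hτ
      have h2 := hF.mono (Nat.le_succ k) π τ hτ
      simp only at h1
      simp only [h1, h2]
    have h := ih (by omega) _ hinv
    simp only [hins, Finset.prod_insert hnot]
    have hre : ∀ π : Order n, (1 - roundProb sel s x π t) *
        (∏ q ∈ Finset.Iio t, (1 - roundProb sel s x π q)) * F π =
        (∏ q ∈ Finset.Iio t, (1 - roundProb sel s x π q)) *
          ((1 - roundProb sel s x π t) * F π) := fun π => by ring
    rw [Finset.sum_congr rfl fun π _ => hre π, h]
    by_cases hks : k + 1 ≤ s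
    · have h0 : ∀ π : Order n, roundProb sel s x π t = 0 := fun π => by
        rw [roundProb, if_neg (by simp [t]; omega), if_pos (by simpa [t] using hks)]
      simp [h0, survival, hks, Nat.le_of_succ_le hks]
    · have h1 := sum_mul_roundProb (x := x) s hsel hx (t := t) (by simp [t]; omega)
        (by simpa [t] using hk) hF
      have h1' : ((k : ℝ) + 1) * ∑ π, F π * roundProb sel s x π t = ∑ π, F π := h1
      have h2 : ∑ π, (1 - roundProb sel s x π t) * F π =
          ∑ π, F π - ∑ π, F π * roundProb sel s x π t := by
        rw [← Finset.sum_sub_distrib]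
        exact Finset.sum_congr rfl fun π _ => by ring
      have hk1 : (k : ℝ) + 1 ≠ 0 := by positivity
      -- NOT in round `k ≥ s` has probability `k / (k + 1)`, so the product telescopes to `s / (k +
      -- 1)`.
      have hc : survival s (k + 1) * ((k : ℝ) + 1) = survival s k * k := by
        rw [survival, if_neg hks, survival]
        push_cast
        rw [div_mul_cancel₀ _ hk1]
        split_ifs with hks'
        · have : s = k := by omega
          rw [this, one_mul]
        · have : (k : ℝ) ≠ 0 := by exact_mod_cast (by omega : k ≠ 0)
          rw [div_mul_cancel₀ _ this]
      rw [h2, ← h1']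
      linear_combination (-∑ π, F π * roundProb sel s x π t) * hc

theorem sum_prod_mul' (hsel : IsParetoRule sel) (hx : Function.Injective x) (t : Fin n)
    {F : Order n → ℝ} (hF : InvariantBefore (t : ℕ) F) :
    ∑ π, (∏ q ∈ Finset.Iio t, (1 - roundProb sel s x π q)) * F π =
        survival s t * ∑ π, F π := sum_prod_mul s hsel hx t t.2 F hF

theorem roundProb_mem (sel : Finset (ℝ × ℝ) → (ℝ × ℝ) × (ℝ × ℝ)) (x : Fin n → ℝ × ℝ)
    (π : Order n) (t : Fin n) :
    0 ≤ roundProb sel s x π t ∧ roundProb sel s x π t ≤ 1 := by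
  unfold roundProb
  split_ifs
  · norm_num
  · norm_num
  · exact paretoProb_mem _ _ _ _

theorem hireWeight_nonneg (sel : Finset (ℝ × ℝ) → (ℝ × ℝ) × (ℝ × ℝ)) (x : Fin n → ℝ × ℝ)
    (π : Order n) (r : Fin n) :
    0 ≤ hireWeight sel s x π r :=
  mul_nonneg (Finset.prod_nonneg fun q _ => sub_nonneg.2 (roundProb_mem s sel x π q).2)
    (roundProb_mem s sel x π r).1

theorem hireWeight_of_lt {r : Fin n} (hr : (r : ℕ) + 1 < n) (hs : (r : ℕ) + 1 ≤ s)
    (π : Order n) : hireWeight sel s x π r = 0 := by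
  rw [hireWeight, roundProb, if_neg hr.ne, if_pos hs, mul_zero]

/-- All rounds contribute equally by symmetry, and over all rounds each order collects every
candidate once. -/
theorem sum_apply_order (v : Fin n → ℝ) (j : Fin n) :
    ∑ π : Order n, v (π j) = (n.factorial : ℝ) * ((∑ i, v i) / n) := by
  have hn : (n : ℝ) ≠ 0 := by exact_mod_cast (Fin.pos j).ne'
  have h1 : ∀ i : Fin n, ∑ π : Order n, v (π i) = ∑ π : Order n, v (π j) := by
    intro i
    rw [← Equiv.sum_comp (Equiv.mulRight (Equiv.swap i j))]
    simp
  have h2 : (n : ℝ) * ∑ π : Order n, v (π j) = (n.factorial : ℝ) * ∑ i, v i := by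
    have : ∑ i : Fin n, ∑ π : Order n, v (π i) = (n : ℝ) * ∑ π : Order n, v (π j) := by
      rw [Finset.sum_congr rfl fun i _ => h1 i]
      simp
    rw [← this, Finset.sum_comm, Finset.sum_congr rfl fun π _ => Equiv.sum_comp π v]
    simp [Fintype.card_perm]
  field_simp
  linarith

/-- The value of a round in which the Pareto procedure is applied. -/
theorem sum_hireWeight_mul_self (hsel : IsParetoRule sel) (hx : Function.Injective x) {r : Fin n}
    (hs : s ≤ (r : ℕ)) (hr : (r : ℕ) + 1 < n) (v : ℝ × ℝ → ℝ) :
    ∑ π, hireWeight sel s x π r * v (x (π r)) = survival s r / ((r : ℝ) + 1) *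
      ∑ π, ∑ c ∈ seen x π r,
        paretoProb (seen x π r) (sel (seen x π r)).1 (sel (seen x π r)).2 c * v c := by
  have hinv : InvariantBefore (r : ℕ) fun π => roundProb sel s x π r * v (x (π r)) :=
    (invariantBefore_roundProb sel s r).mul (invariantBefore_apply (fun i => v (x i)) le_rfl)
  have h1 := sum_prod_mul' s hsel hx r hinv
  have h2 := sum_mul_roundProb_mul sel s hx hs hr (F := fun _ => 1) (fun _ _ _ => rfl) v
  simp only [one_mul] at h2
  simp only [hireWeight, mul_assoc]
  rw [h1, ← h2]
  field_simp

/-- A first HIRE in round `r` is independent of who arrives in a later round `j`, so that candidate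
is worth the plain average. -/
theorem sum_hireWeight_mul_later (hsel : IsParetoRule sel) (hx : Function.Injective x)
    {r j : Fin n} (hrj : r < j) (v : Fin n → ℝ) :
    ∑ π, hireWeight sel s x π r * v (π j) =
      (∑ i, v i) / n * ∑ π, hireWeight sel s x π r := by
  have hr : (r : ℕ) + 1 < n := lt_of_le_of_lt hrj j.2
  by_cases hs : (r : ℕ) + 1 ≤ s
  · simp [hireWeight_of_lt s hr hs]
  have key : ∀ w : Fin n → ℝ, ∑ π, hireWeight sel s x π r * w (π j) =
      survival s r / ((r : ℝ) + 1) * ((n.factorial : ℝ) * ((∑ i, w i) / n)) := by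
    intro w
    have hinv : InvariantBefore (r : ℕ) fun π => roundProb sel s x π r * w (π j) :=
      (invariantBefore_roundProb sel s r).mul (invariantBefore_apply w (by omega))
    have h1 := sum_prod_mul' s hsel hx r hinv
    have h2 := sum_mul_roundProb s hsel hx (t := r) (by omega) hr
      (invariantBefore_apply w (k := (r : ℕ) + 1) (j := j) hrj)
    simp only [hireWeight, mul_assoc]
    rw [h1, ← sum_apply_order w j, ← h2]
    simp only [mul_comm (w _)]
    field_simp
  have h1 := key fun _ => 1
  have hn : (n : ℝ) ≠ 0 := by exact_mod_cast (by omega : n ≠ 0)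
  simp only [mul_one, Finset.sum_const, Finset.card_univ, Fintype.card_fin, nsmul_eq_mul,
    div_self hn] at h1
  rw [key v, h1]
  ring

theorem card_seen (hx : Function.Injective x) (π : Order n) (t : Fin n) :
    ((seen x π t).card : ℝ) = (t : ℝ) + 1 := by
  rw [seen, Finset.card_image_of_injective _ (f := fun j => x (π j)) (hx.comp π.injective),
    Fin.card_Iic]
  push_cast
  rfl

theorem sum_seen (hx : Function.Injective x) (π : Order n) (t : Fin n) (v : ℝ × ℝ → ℝ) :
    ∑ c ∈ seen x π t, v c = ∑ j ∈ Finset.Iic t, v (x (π j)) := by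
  rw [seen, Finset.sum_image fun i _ j _ h => π.injective (hx h)]

/-- Upon HIRE, the candidate is at least average. -/
theorem le_sum_hireWeight_mul_self (hsel : IsParetoRule sel) (hx : Function.Injective x)
    (r : Fin n) :
    (∑ i, (x i).1) / n * ∑ π, hireWeight sel s x π r ≤
      ∑ π, hireWeight sel s x π r * (x (π r)).1 := by
  by_cases hlast : (r : ℕ) + 1 = n
  -- The last round hires without selection, so equality holds there.
  · have hinv : ∀ w : Fin n → ℝ, ∑ π, hireWeight sel s x π r * w (π r) =
        survival s r * ((n.factorial : ℝ) * ((∑ i, w i) / n)) := by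
      intro w
      have h1 := sum_prod_mul' s hsel hx r (invariantBefore_apply w (k := (r : ℕ)) (j := r) le_rfl)
      rw [← sum_apply_order w r, ← h1]
      refine Finset.sum_congr rfl fun π _ => ?_
      rw [hireWeight, roundProb, if_pos hlast, mul_one]
    have h1 := hinv fun _ => 1
    have hn : (n : ℝ) ≠ 0 := by exact_mod_cast (by omega : n ≠ 0)
    simp only [mul_one, Finset.sum_const, Finset.card_univ, Fintype.card_fin, nsmul_eq_mul,
      div_self hn] at h1
    rw [h1, hinv fun i => (x i).1]
    exact le_of_eq (by ring)
  have hr : (r : ℕ) + 1 < n := by omega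
  by_cases hs : (r : ℕ) + 1 ≤ s
  · simp [hireWeight_of_lt s hr hs]
  have h1 := sum_hireWeight_mul_self s hsel hx (r := r) (by omega) hr fun p => p.1
  have h2 := sum_hireWeight_mul_self s hsel hx (r := r) (by omega) hr fun _ => 1
  have h3 : ∀ π : Order n, ∑ c ∈ seen x π r,
      paretoProb (seen x π r) (sel (seen x π r)).1 (sel (seen x π r)).2 c = 1 := fun π =>
    have hp := hsel.isParetoPair (seen_nonempty x π r)
    sum_paretoProb hp.1 hp.2.1
  simp only [mul_one, h3, Finset.sum_const, Finset.card_univ, Fintype.card_perm, Fintype.card_fin,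
    nsmul_eq_mul] at h2
  rw [h1, h2, mul_left_comm]
  refine mul_le_mul_of_nonneg_left ?_ (div_nonneg (survival_nonneg _ _) (by positivity))
  -- The average of a uniform sample has the overall average as its expectation.
  have h4 : ∑ π : Order n, avgReceiver (seen x π r) = (n.factorial : ℝ) * ((∑ i, (x i).1) / n) := by
    have h5 : ∀ π : Order n, avgReceiver (seen x π r) =
        (∑ j ∈ Finset.Iic r, (x (π j)).1) / ((r : ℝ) + 1) := fun π => by
      rw [avgReceiver, card_seen hx, sum_seen hx π r fun p => p.1]
    have h6 : (((Finset.Iic r).card : ℕ) : ℝ) = (r : ℝ) + 1 := by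
      rw [Fin.card_Iic]
      push_cast
      rfl
    rw [Finset.sum_congr rfl fun π _ => h5 π, ← Finset.sum_div, Finset.sum_comm,
      Finset.sum_congr rfl fun j _ => sum_apply_order (fun i => (x i).1) j, Finset.sum_const,
      nsmul_eq_mul, h6]
    field_simp
  rw [mul_comm, ← h4]
  refine Finset.sum_le_sum fun π _ => ?_
  have hp := hsel.isParetoPair (seen_nonempty x π r)
  rw [sum_paretoProb_mul_fst hp.1 hp.2.1]
  exact hp.avgReceiver_le

end Exchangeability

/-! ### Persuasiveness -/

section Receiver

open scoped Classical

variable {n : ℕ}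

theorem hiresAt_unique {d : ReceiverStrategy n} {k : ℕ} {σ : Fin n → Bool} {r r' : Fin n}
    (h : HiresAt d k σ r) (h' : HiresAt d k σ r') : r = r' := by
  rcases lt_trichotomy r r' with hlt | rfl | hlt
  · exact absurd h.2.1 (by simp [h'.2.2 r h.1 hlt])
  · rfl
  · exact absurd h'.2.1 (by simp [h.2.2 r' h'.1 hlt])

theorem hiredValue_of_hiresAt {v : Fin n → ℝ} {d : ReceiverStrategy n} {k : ℕ} {π : Order n}
    {σ : Fin n → Bool} {r : Fin n} (h : HiresAt d k σ r) : hiredValue v d k π σ = v (π r) := by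
  rw [hiredValue, Finset.sum_eq_single r, if_pos h]
  · intro q _ hq
    exact if_neg fun h' => hq (hiresAt_unique h' h)
  · simp

theorem hiredValue_of_not {v : Fin n → ℝ} {d : ReceiverStrategy n} {k : ℕ} {π : Order n}
    {σ : Fin n → Bool} (h : ∀ r, ¬ HiresAt d k σ r) : hiredValue v d k π σ = 0 :=
  Finset.sum_eq_zero fun r _ => if_neg (h r)

theorem hiresAt_obedient_hireOnly {k : ℕ} {r : Fin n} (h : k ≤ (r : ℕ)) :
    HiresAt (obedient n) k (hireOnly r) r := by
  refine ⟨h, by simp [obedient, hireOnly], fun q _ hq => by simp [obedient, hireOnly, hq.ne]⟩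

/-- Decisions up to round `r` use only the signals up to round `r`. -/
theorem hiresAt_congr {d : ReceiverStrategy n} {k : ℕ} {σ τ : Fin n → Bool} {r : Fin n}
    (h : ∀ q, q ≤ r → σ q = τ q) (hr : HiresAt d k σ r) : HiresAt d k τ r := by
  have hrestr : ∀ q, q ≤ r → (fun j : Set.Iic q => σ j.1) = fun j => τ j.1 := fun q hq =>
    funext fun j => h j.1 (le_trans j.2 hq)
  refine ⟨hr.1, ?_, fun q hk hq => ?_⟩
  · rw [← hrestr r le_rfl]
    exact hr.2.1
  · rw [← hrestr q hq.le]
    exact hr.2.2 q hk hq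

theorem observed_hireOnly {t r : Fin n} {b : Bool} :
    Observed t b (hireOnly r) ↔ if b = true then r = t else t < r := by
  unfold Observed hireOnly
  cases b
  · simp only [decide_eq_false_iff_not, Bool.false_eq_true, if_false]
    constructor
    · rintro ⟨h1, h2⟩
      by_contra! h
      exact h1 r (lt_of_le_of_ne h (Ne.symm h2)) rfl
    · intro h
      exact ⟨fun q hq => (hq.trans h).ne, h.ne⟩
  · simp only [decide_eq_false_iff_not, decide_eq_true_eq, if_true]
    constructor
    · exact fun h => h.2.symm
    · rintro rfl
      exact ⟨fun q hq => hq.ne, rfl⟩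

variable {sel : Finset (ℝ × ℝ) → (ℝ × ℝ) × (ℝ × ℝ)} (s : ℕ) {ρ ξ : Fin n → ℝ}

theorem sum_hireWeight (hn : 1 ≤ n) (π : Order n) :
    ∑ r, hireWeight sel s (fun i => (ρ i, ξ i)) π r = 1 := by
  have h := sum_signalProb ρ ξ (growingPareto sel n s) π
  rw [← Finset.sum_subset (Finset.subset_univ (Finset.univ.image (hireOnly (n := n)))),
    Finset.sum_image fun _ _ _ _ h => hireOnly_injective h] at h
  · rw [← h]
    exact Finset.sum_congr rfl fun r _ => (signalProb_hireOnly sel s ρ ξ π r).symm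
  · intro σ _ hσ
    refine signalProb_eq_zero sel s ρ ξ π hn ?_
    rintro r rfl
    exact hσ (Finset.mem_image_of_mem _ (Finset.mem_univ r))

/-- The candidate of round `q` is worth `m` overall, exactly `m` if the first HIRE precedes `q`, and
at least `m` if it is in `q`. Subtracting, it is worth at most `m` on the remaining event, where the
hired candidate is worth at least `m`. -/
theorem sum_hireWeight_mul_before (hsel : IsParetoRule sel)
    (hx : Function.Injective fun i => (ρ i, ξ i)) (q : Fin n) :
    ∑ r ∈ Finset.Ioi q, ∑ π, hireWeight sel s (fun i => (ρ i, ξ i)) π r * ρ (π q) ≤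
      ∑ r ∈ Finset.Ioi q, ∑ π, hireWeight sel s (fun i => (ρ i, ξ i)) π r * ρ (π r) := by
  have hn : 1 ≤ n := Fin.pos q
  have hn' : (n : ℝ) ≠ 0 := by exact_mod_cast (by omega : n ≠ 0)
  set m := (∑ i, ρ i) / n with hm
  have htot : ∀ v : Fin n → ℝ,
      ∑ r, ∑ π, hireWeight sel s (fun i => (ρ i, ξ i)) π r * v (π q) =
        (n.factorial : ℝ) * ((∑ i, v i) / n) := by
    intro v
    rw [Finset.sum_comm, ← sum_apply_order v q]
    refine Finset.sum_congr rfl fun π _ => ?_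
    rw [← Finset.sum_mul, sum_hireWeight s hn, one_mul]
  have hsplit : ∀ f : Fin n → ℝ, ∑ r, f r =
      ∑ r ∈ Finset.Iio q, f r + f q + ∑ r ∈ Finset.Ioi q, f r := by
    intro f
    have h1 : (Finset.univ : Finset (Fin n)) = insert q (Finset.Iio q) ∪ Finset.Ioi q := by
      ext r
      simp only [Finset.mem_univ, Finset.mem_union, Finset.mem_insert, Finset.mem_Iio,
        Finset.mem_Ioi, true_iff]
      rcases lt_trichotomy r q with h | h | h <;> simp [h]
    rw [h1, Finset.sum_union, Finset.sum_insert (by simp), add_comm (f q)]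
    refine Finset.disjoint_left.2 fun r hr => ?_
    simp only [Finset.mem_insert, Finset.mem_Iio, Finset.mem_Ioi, not_lt] at hr ⊢
    rcases hr with rfl | hr
    · exact le_rfl
    · exact hr.le
  have h1 := htot ρ
  have h2 := htot fun _ => 1
  simp only [mul_one, Finset.sum_const, Finset.card_univ, Fintype.card_fin, nsmul_eq_mul,
    div_self hn'] at h2
  rw [hsplit] at h1 h2
  have h3 : ∑ r ∈ Finset.Iio q, ∑ π, hireWeight sel s (fun i => (ρ i, ξ i)) π r * ρ (π q) =
      m * ∑ r ∈ Finset.Iio q, ∑ π, hireWeight sel s (fun i => (ρ i, ξ i)) π r := by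
    rw [Finset.mul_sum]
    exact Finset.sum_congr rfl fun r hr =>
      sum_hireWeight_mul_later s hsel hx (Finset.mem_Iio.1 hr) ρ
  have h4 := le_sum_hireWeight_mul_self s hsel hx q
  have h5 : m * ∑ r ∈ Finset.Ioi q, ∑ π, hireWeight sel s (fun i => (ρ i, ξ i)) π r ≤
      ∑ r ∈ Finset.Ioi q, ∑ π, hireWeight sel s (fun i => (ρ i, ξ i)) π r * ρ (π r) := by
    rw [Finset.mul_sum]
    exact Finset.sum_le_sum fun r _ => le_sum_hireWeight_mul_self s hsel hx r
  simp only [← hm] at h1 h4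
  have h6 := congrArg (m * ·) h2
  simp only [mul_add] at h6
  linarith

/-- The value to the receiver of `d` from round `k` on if the first HIRE comes in round `r`. -/
theorem sum_hireWeight_mul_hiredValue_le (hsel : IsParetoRule sel) (hρ : ∀ i, 0 ≤ ρ i)
    (hx : Function.Injective fun i => (ρ i, ξ i)) {d : ReceiverStrategy n} {k : ℕ} {r : Fin n}
    (hd : ∀ j, HiresAt d k (hireOnly r) j → r ≤ j) :
    ∑ π, hireWeight sel s (fun i => (ρ i, ξ i)) π r * hiredValue ρ d k π (hireOnly r) ≤
      ∑ π, hireWeight sel s (fun i => (ρ i, ξ i)) π r * ρ (π r) := by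
  by_cases h : ∃ j, HiresAt d k (hireOnly r) j
  · obtain ⟨j, hj⟩ := h
    simp only [hiredValue_of_hiresAt hj]
    rcases (hd j hj).eq_or_lt with rfl | hlt
    · exact le_rfl
    · rw [sum_hireWeight_mul_later s hsel hx hlt ρ]
      exact le_sum_hireWeight_mul_self s hsel hx r
  · push Not at h
    refine Finset.sum_le_sum fun π _ => ?_
    rw [hiredValue_of_not h]
    exact mul_le_mul_of_nonneg_left (hρ _) (hireWeight_nonneg s sel _ π r)

theorem persuasive_growingPareto (hsel : IsParetoRule sel) (hn : 1 ≤ n) (hρ : ∀ i, 0 ≤ ρ i)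
    (hx : Function.Injective fun i => (ρ i, ξ i)) :
    Persuasive ρ ξ (growingPareto sel n s) := by
  intro t b d
  rw [expectation_growingPareto sel s ρ ξ hn, expectation_growingPareto sel s ρ ξ hn]
  refine div_le_div_of_nonneg_right ?_ (Nat.cast_nonneg _)
  cases b
  · have hob : ∀ r, Observed t false (hireOnly r) ↔ t < r := fun r => by
      simp [observed_hireOnly]
    simp only [hob]
    have hrhs : ∀ r, ∑ π, hireWeight sel s (fun i => (ρ i, ξ i)) π r *
          (if t < r then hiredValue ρ (obedient n) t π (hireOnly r) else 0) =
        if r ∈ Finset.Ioi t then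
          ∑ π, hireWeight sel s (fun i => (ρ i, ξ i)) π r * ρ (π r) else 0 := by
      intro r
      by_cases h : t < r
      · have h' : (t : ℕ) ≤ r := h.le
        simp only [h, if_true, Finset.mem_Ioi, hiredValue_of_hiresAt (hiresAt_obedient_hireOnly h')]
      · simp [h]
    have hlhs : ∀ r, ∑ π, hireWeight sel s (fun i => (ρ i, ξ i)) π r *
          (if t < r then hiredValue ρ d t π (hireOnly r) else 0) =
        if r ∈ Finset.Ioi t then
          ∑ π, hireWeight sel s (fun i => (ρ i, ξ i)) π r * hiredValue ρ d t π (hireOnly r)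
        else 0 := by
      intro r
      by_cases h : t < r <;> simp [h]
    rw [Finset.sum_congr rfl fun r _ => hrhs r, Finset.sum_congr rfl fun r _ => hlhs r,
      Finset.sum_ite_mem, Finset.sum_ite_mem, Finset.univ_inter]
    have hagree : ∀ r q : Fin n, q < r → ∀ j, j ≤ q → hireOnly r j = false := fun r q hq j hj => by
      simp [hireOnly, (hj.trans_lt hq).ne]
    -- Here `q` is the round in which `d` hires as long as it sees only NOT. If the HIRE comes by
    -- round `q`, then `d` hires no earlier than it; if it comes after `q`, then `d` takes the
    -- candidate of round `q`.
    by_cases hq : ∃ q, HiresAt d t (fun _ => false) q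
    · obtain ⟨q, hq⟩ := hq
      have hsplit : Finset.Ioi t = Finset.Ioc t q ∪ Finset.Ioi q :=
        have htq : t ≤ q := hq.1
        Finset.coe_injective (by push_cast; exact (Set.Ioc_union_Ioi_eq_Ioi htq).symm)
      have hdisj : Disjoint (Finset.Ioc t q) (Finset.Ioi q) :=
        Finset.disjoint_left.2 fun r hr hr' =>
          absurd (Finset.mem_Ioi.1 hr') (not_lt.2 (Finset.mem_Ioc.1 hr).2)
      rw [hsplit, Finset.sum_union hdisj, Finset.sum_union hdisj]
      refine add_le_add (Finset.sum_le_sum fun r hr => ?_) ?_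
      · refine sum_hireWeight_mul_hiredValue_le s hsel hρ hx fun j hj => ?_
        by_contra! hjr
        have := hiresAt_unique (hiresAt_congr (hagree r j hjr) hj) hq
        rw [this] at hjr
        exact absurd (Finset.mem_Ioc.1 hr).2 (not_le.2 hjr)
      · refine le_trans (le_of_eq ?_) (sum_hireWeight_mul_before s hsel hx q)
        refine Finset.sum_congr rfl fun r hr => Finset.sum_congr rfl fun π _ => ?_
        have hr' : HiresAt d t (hireOnly r) q :=
          hiresAt_congr (fun j hj => (hagree r q (Finset.mem_Ioi.1 hr) j hj).symm) hq
        rw [hiredValue_of_hiresAt hr']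
    · push Not at hq
      refine Finset.sum_le_sum fun r _ => ?_
      refine sum_hireWeight_mul_hiredValue_le s hsel hρ hx fun j hj => ?_
      by_contra! hjr
      exact hq j (hiresAt_congr (hagree r j hjr) hj)
  · have hob : ∀ r, Observed t true (hireOnly r) ↔ r = t := fun r => by
      simp [observed_hireOnly]
    simp only [hob]
    rw [Finset.sum_eq_single t, Finset.sum_eq_single t]
    · simp only [if_true, hiredValue_of_hiresAt (hiresAt_obedient_hireOnly (le_refl (t : ℕ)))]
      exact sum_hireWeight_mul_hiredValue_le s hsel hρ hx fun j hj => Fin.le_def.2 hj.1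
    · intro r _ hr
      simp [hr]
    · simp
    · intro r _ hr
      simp [hr]
    · simp

theorem senderUtility_growingPareto (hn : 1 ≤ n) :
    senderUtility ρ ξ (growingPareto sel n s) =
      (∑ r, ∑ π, hireWeight sel s (fun i => (ρ i, ξ i)) π r * ξ (π r)) / (n.factorial : ℝ) := by
  rw [senderUtility, expectation_growingPareto sel s ρ ξ hn]
  simp only [hiredValue_of_hiresAt (hiresAt_obedient_hireOnly (Nat.zero_le _))]

end Receiver

/-! ### The upper bound on the benchmark -/

section Benchmark

open scoped Classical

variable {n : ℕ} {ρ ξ : Fin n → ℝ}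

theorem expectation_add (ρ ξ : Fin n → ℝ) (M : Mechanism n)
    (F G : Order n → (Fin n → Bool) → ℝ) :
    expectation ρ ξ M F + expectation ρ ξ M G = expectation ρ ξ M fun π σ => F π σ + G π σ := by
  simp only [expectation, mul_add, Finset.sum_add_distrib, add_div]

/-- The probability that candidate `i` is hired. -/
noncomputable def hiredProb (ρ ξ : Fin n → ℝ) (M : Mechanism n) (i : Fin n) : ℝ :=
  expectation ρ ξ M fun π σ => hiredValue (Pi.single i 1) (obedient n) 0 π σ

theorem hiredValue_eq_sum (v : Fin n → ℝ) (d : ReceiverStrategy n) (k : ℕ) (π : Order n)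
    (σ : Fin n → Bool) :
    hiredValue v d k π σ = ∑ i, hiredValue (Pi.single i 1) d k π σ * v i := by
  simp only [hiredValue, Finset.sum_mul]
  rw [Finset.sum_comm]
  refine Finset.sum_congr rfl fun r _ => ?_
  split_ifs
  · simp [Pi.single_apply]
  · simp

theorem expectation_hiredValue (M : Mechanism n) (v : Fin n → ℝ) :
    expectation ρ ξ M (fun π σ => hiredValue v (obedient n) 0 π σ) =
      ∑ i, hiredProb ρ ξ M i * v i := by
  simp only [hiredProb, expectation, div_mul_eq_mul_div, ← Finset.sum_div]
  congr 1
  simp only [Finset.sum_mul]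
  rw [Finset.sum_comm (s := (Finset.univ : Finset (Fin n)))]
  refine Finset.sum_congr rfl fun π _ => ?_
  rw [Finset.sum_comm (s := (Finset.univ : Finset (Fin n)))]
  refine Finset.sum_congr rfl fun σ _ => ?_
  rw [hiredValue_eq_sum v, Finset.mul_sum]
  simp only [mul_assoc]

theorem hiredProb_nonneg (M : Mechanism n) (i : Fin n) : 0 ≤ hiredProb ρ ξ M i := by
  refine div_nonneg (Finset.sum_nonneg fun π _ => Finset.sum_nonneg fun σ _ =>
    mul_nonneg (signalProb_nonneg ρ ξ M π σ) (Finset.sum_nonneg fun r _ => ?_)) (Nat.cast_nonneg _)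
  split_ifs
  · by_cases h : π r = i <;> simp [h]
  · exact le_rfl

theorem expectation_mono (M : Mechanism n) {F G : Order n → (Fin n → Bool) → ℝ}
    (h : ∀ π σ, F π σ ≤ G π σ) : expectation ρ ξ M F ≤ expectation ρ ξ M G :=
  div_le_div_of_nonneg_right (Finset.sum_le_sum fun π _ => Finset.sum_le_sum fun σ _ =>
    mul_le_mul_of_nonneg_left (h π σ) (signalProb_nonneg ρ ξ M π σ)) (Nat.cast_nonneg _)

theorem expectation_of_signals_const (M : Mechanism n) (f : Order n → ℝ) :
    expectation ρ ξ M (fun π _ => f π) = (∑ π, f π) / (n.factorial : ℝ) := by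
  simp only [expectation, ← Finset.sum_mul, sum_signalProb, one_mul]

theorem sum_hiredProb_le_one (M : Mechanism n) : ∑ i, hiredProb ρ ξ M i ≤ 1 := by
  have h := expectation_hiredValue (ρ := ρ) (ξ := ξ) M fun _ => 1
  simp only [mul_one] at h
  rw [← h]
  have h1 : expectation ρ ξ M (fun _ _ => 1) = 1 := by
    rw [expectation_of_signals_const M fun _ => 1]
    have : (n.factorial : ℝ) ≠ 0 := by exact_mod_cast n.factorial_ne_zero
    simp [Fintype.card_perm, this]
  refine (expectation_mono M fun π σ => ?_).trans h1.le
  by_cases hh : ∃ j, HiresAt (obedient n) 0 σ j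
  · obtain ⟨j, hj⟩ := hh
    rw [hiredValue_of_hiresAt hj]
  · push Not at hh
    rw [hiredValue_of_not hh]
    exact zero_le_one

/-- In a persuasive mechanism, the receiver does at least as well as by hiring the first
candidate. -/
theorem Persuasive.le_sum_hiredProb_mul (hn : 1 ≤ n) {M : Mechanism n}
    (hM : Persuasive ρ ξ M) : (∑ i, ρ i) / n ≤ ∑ i, hiredProb ρ ξ M i * ρ i := by
  let t : Fin n := ⟨0, hn⟩
  -- The two signals of the first round partition all outcomes, so the two conditions add up to an
  -- unconditional comparison with hiring the first arrival.
  have h := add_le_add (hM t true fun _ _ => true) (hM t false fun _ _ => true)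
  rw [expectation_add, expectation_add] at h
  have hob : ∀ (σ : Fin n → Bool) (y : ℝ),
      (if Observed t true σ then y else 0) + (if Observed t false σ then y else 0) = y := by
    intro σ y
    have hbefore : ∀ r : Fin n, r < t → σ r = false := fun r hr =>
      absurd (Fin.lt_def.1 hr) (Nat.not_lt_zero _)
    by_cases h : σ t = true
    · rw [if_pos ⟨hbefore, h⟩, if_neg (by rintro ⟨-, h'⟩; simp [h] at h'), add_zero]
    · rw [if_neg (fun h' => h h'.2), if_pos ⟨hbefore, by simpa using h⟩, zero_add]
  simp only [hob] at h
  have hfirst : ∀ (π : Order n) (σ : Fin n → Bool),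
      hiredValue ρ (fun _ _ => true) (t : ℕ) π σ = ρ (π t) := fun π σ =>
    hiredValue_of_hiresAt ⟨le_rfl, rfl, fun q _ hq => absurd (Fin.lt_def.1 hq) (Nat.not_lt_zero _)⟩
  simp only [hfirst] at h
  rw [expectation_of_signals_const M fun π => ρ (π t), sum_apply_order ρ t,
    mul_div_cancel_left₀ _ (by exact_mod_cast n.factorial_ne_zero)] at h
  rw [← expectation_hiredValue M ρ]
  exact h

/-- The benchmark is at most the value of the Pareto procedure on all pairs. -/
theorem OPT_le (hn : 1 ≤ n) (hρ : ∀ i, 0 ≤ ρ i) (hξ : ∀ i, 0 ≤ ξ i)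
    (hx : Function.Injective fun i => (ρ i, ξ i)) {a b : ℝ × ℝ}
    (hab : IsParetoPair (Finset.univ.image fun i => (ρ i, ξ i)) a b) :
    OPT ρ ξ ≤ (paretoPoint (Finset.univ.image fun i => (ρ i, ξ i)) a b).2 := by
  set A := Finset.univ.image fun i => (ρ i, ξ i) with hA
  have havg : avgReceiver A = (∑ i, ρ i) / n := by
    rw [avgReceiver, hA, Finset.sum_image fun _ _ _ _ h => hx h,
      Finset.card_image_of_injective _ hx]
    simp
  let j : Fin n := ⟨0, hn⟩
  have hbound : ∀ M : Mechanism n, Persuasive ρ ξ M →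
      senderUtility ρ ξ M ≤ (paretoPoint A a b).2 := by
    intro M hM
    -- The probability that nobody is hired is given to candidate `j`. As valuations are
    -- nonnegative, neither coordinate decreases.
    let p : Fin n → ℝ := fun i =>
      hiredProb ρ ξ M i + Pi.single (M := fun _ => ℝ) j (1 - ∑ i, hiredProb ρ ξ M i) i
    have hp0 : ∀ i, 0 ≤ p i := by
      intro i
      refine add_nonneg (hiredProb_nonneg M i) ?_
      by_cases h : i = j
      · subst h
        simpa using sum_hiredProb_le_one M
      · simp [h]
    have hp1 : ∑ i, p i = 1 := by
      simp [p, Finset.sum_add_distrib]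
    have hple : ∀ i, hiredProb ρ ξ M i ≤ p i := by
      intro i
      refine le_add_of_nonneg_right ?_
      by_cases h : i = j
      · subst h
        simpa using sum_hiredProb_le_one M
      · simp [h]
    have hq : (∑ i, p i • ((ρ i, ξ i) : ℝ × ℝ)) ∈ convexHull ℝ (A : Set (ℝ × ℝ)) :=
      (convex_convexHull ℝ _).sum_mem (fun i _ => hp0 i) hp1 fun i _ =>
        subset_convexHull ℝ _ (Finset.mem_coe.2 (Finset.mem_image_of_mem _ (Finset.mem_univ i)))
    have h1 : (∑ i, p i • ((ρ i, ξ i) : ℝ × ℝ)).1 = ∑ i, p i * ρ i := by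
      simp [Prod.fst_sum]
    have h2 : (∑ i, p i • ((ρ i, ξ i) : ℝ × ℝ)).2 = ∑ i, p i * ξ i := by
      simp [Prod.snd_sum]
    have h3 := hab.snd_le hq (by
      rw [h1, havg]
      refine (hM.le_sum_hiredProb_mul hn).trans (Finset.sum_le_sum fun i _ => ?_)
      exact mul_le_mul_of_nonneg_right (hple i) (hρ i))
    rw [h2] at h3
    refine le_trans ?_ h3
    rw [senderUtility, expectation_hiredValue M ξ]
    exact Finset.sum_le_sum fun i _ => mul_le_mul_of_nonneg_right (hple i) (hξ i)
  have hV : 0 ≤ (paretoPoint A a b).2 := by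
    have hnn : ∀ c ∈ A, 0 ≤ c.2 := by
      intro c hc
      obtain ⟨i, -, rfl⟩ := Finset.mem_image.1 hc
      exact hξ i
    simp only [paretoPoint, Prod.snd_add, Prod.smul_snd, smul_eq_mul]
    exact add_nonneg (mul_nonneg (uniformCdf_nonneg _) (hnn a hab.1))
      (mul_nonneg (sub_nonneg.2 (uniformCdf_le_one _)) (hnn b hab.2.1))
  refine Real.sSup_le ?_ hV
  rintro u ⟨M, hM, rfl⟩
  exact hbound M hM

end Benchmark

/-! ### Probability that given candidates arrive early -/

section Sampling

open scoped Classical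

variable {n : ℕ}

/-- The number of orders in which all candidates in `S` arrive up to round `t`. -/
noncomputable def numEarly (t : Fin n) (S : Finset (Fin n)) : ℕ :=
  (Finset.univ.filter fun π : Order n => S ⊆ (Finset.Iic t).image π).card

/-- Relabelling candidates by a permutation that carries `S` to `T` is a bijection of orders. -/
theorem numEarly_congr (t : Fin n) {S T : Finset (Fin n)} (h : S.card = T.card) :
    numEarly t S = numEarly t T := by
  let e : { i // i ∈ S } ≃ { i // i ∈ T } := Finset.equivOfCardEq h
  let τ : Equiv.Perm (Fin n) := e.extendSubtype
  have hT : S.image τ = T := by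
    refine Finset.eq_of_subset_of_card_le ?_ ?_
    · intro i hi
      obtain ⟨j, hj, rfl⟩ := Finset.mem_image.1 hi
      exact e.extendSubtype_mem j hj
    · rw [Finset.card_image_of_injective _ τ.injective, h]
  refine Finset.card_bij (fun π _ => τ * π) ?_ (fun _ _ _ _ h => mul_left_cancel h) ?_
  · intro π hπ
    rw [Finset.mem_filter] at hπ ⊢
    refine ⟨Finset.mem_univ _, ?_⟩
    rw [← hT, Equiv.Perm.coe_mul, ← Finset.image_image]
    exact Finset.image_subset_image hπ.2
  · intro π hπ
    refine ⟨τ⁻¹ * π, ?_, by simp⟩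
    rw [Finset.mem_filter] at hπ ⊢
    refine ⟨Finset.mem_univ _, ?_⟩
    have hsub := Finset.image_subset_image (f := (τ⁻¹ : Equiv.Perm (Fin n))) hπ.2
    rw [← hT, Finset.image_image, Finset.image_image, ← Equiv.Perm.coe_mul,
      ← Equiv.Perm.coe_mul, inv_mul_cancel, Equiv.Perm.coe_one, Finset.image_id] at hsub
    exact hsub

/-- Double counting of pairs of an order and an early set of the given size: each order has `C(t+1,
|S|)` early sets. -/
theorem choose_mul_numEarly (t : Fin n) (S : Finset (Fin n)) :
    n.choose S.card * numEarly t S = n.factorial * ((t : ℕ) + 1).choose S.card := by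
  have h1 : ∑ T ∈ Finset.powersetCard S.card (Finset.univ : Finset (Fin n)), numEarly t T =
      n.choose S.card * numEarly t S := by
    rw [Finset.sum_congr rfl fun T hT => numEarly_congr t (Finset.mem_powersetCard.1 hT).2]
    simp
  rw [← h1]
  simp only [numEarly, Finset.card_filter]
  rw [Finset.sum_comm]
  have h2 : ∀ π : Order n, ∑ T ∈ Finset.powersetCard S.card (Finset.univ : Finset (Fin n)),
      (if T ⊆ (Finset.Iic t).image π then 1 else 0) = ((t : ℕ) + 1).choose S.card := by
    intro π
    rw [← Finset.card_filter]
    have h3 : (Finset.powersetCard S.card (Finset.univ : Finset (Fin n))).filter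
        (fun T => T ⊆ (Finset.Iic t).image π) =
        Finset.powersetCard S.card ((Finset.Iic t).image π) := by
      ext T
      simp [Finset.mem_powersetCard, and_comm]
    rw [h3, Finset.card_powersetCard, Finset.card_image_of_injective _ π.injective, Fin.card_Iic]
  rw [Finset.sum_congr rfl fun π _ => h2 π]
  simp [Fintype.card_perm]

theorem numEarly_anti (t : Fin n) {S T : Finset (Fin n)} (h : S ⊆ T) :
    numEarly t T ≤ numEarly t S := by
  refine Finset.card_le_card fun π hπ => ?_
  rw [Finset.mem_filter] at hπ ⊢
  exact ⟨hπ.1, h.trans hπ.2⟩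

/-- The indices may coincide; enlarging the set to three elements only makes being early rarer. -/
theorem le_choose_mul_numEarly (hn : 3 ≤ n) (t i j l : Fin n) :
    n.factorial * ((t : ℕ) + 1).choose 3 ≤ n.choose 3 * numEarly t {i, j, l} := by
  obtain ⟨S, hS, hS3⟩ := Finset.exists_superset_card_eq (s := ({i, j, l} : Finset (Fin n)))
    (n := 3) Finset.card_le_three (by simpa using hn)
  have h := choose_mul_numEarly t S
  rw [hS3] at h
  rw [← h]
  exact Nat.mul_le_mul_left _ (numEarly_anti t hS)

end Sampling

/-! ### The value of the procedure on a subset -/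

section Subsets

open scoped Classical

variable {n : ℕ} {x : Fin n → ℝ × ℝ}

theorem avgReceiver_image (hx : Function.Injective x) (I : Finset (Fin n)) :
    avgReceiver (I.image x) = (∑ i ∈ I, (x i).1) / (I.card : ℝ) := by
  rw [avgReceiver, Finset.sum_image fun _ _ _ _ h => hx h, Finset.card_image_of_injective _ hx]

theorem paretoPoint_snd_nonneg {A : Finset (ℝ × ℝ)} (hA : ∀ c ∈ A, 0 ≤ c.2) {a b : ℝ × ℝ}
    (ha : a ∈ A) (hb : b ∈ A) : 0 ≤ (paretoPoint A a b).2 := by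
  simp only [paretoPoint, Prod.snd_add, Prod.smul_snd, smul_eq_mul]
  exact add_nonneg (mul_nonneg (uniformCdf_nonneg _) (hA a ha))
    (mul_nonneg (sub_nonneg.2 (uniformCdf_le_one _)) (hA b hb))

/-- On a set containing the selected pair, the value of the Pareto procedure is at least the
proportion of the total shortfall `max (μ - ρ i) 0` that falls into the set. -/
theorem exists_weights (hx : Function.Injective x) (hξ : ∀ i, 0 ≤ (x i).2) {a b : ℝ × ℝ}
    (hab : IsParetoPair (Finset.univ.image x) a b) :
    ∃ c : Fin n → ℝ, (∀ i, 0 ≤ c i) ∧ ∑ i, c i = 1 ∧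
      ∀ I : Finset (Fin n), a ∈ I.image x → b ∈ I.image x →
        ∀ a' b', IsParetoPair (I.image x) a' b' →
          (∑ i ∈ I, c i) * (paretoPoint (Finset.univ.image x) a b).2 ≤
            (paretoPoint (I.image x) a' b').2 := by
  set A := Finset.univ.image x with hA
  set P := paretoPoint A a b with hP
  set m := avgReceiver A with hm
  have hP1 : m ≤ P.1 := hab.avgReceiver_le
  have hP2 : 0 ≤ P.2 := by
    refine paretoPoint_snd_nonneg (fun c hc => ?_) hab.1 hab.2.1
    obtain ⟨i, -, rfl⟩ := Finset.mem_image.1 hc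
    exact hξ i
  have hPI : ∀ I : Finset (Fin n), a ∈ I.image x → b ∈ I.image x →
      P ∈ convexHull ℝ ((I.image x : Finset (ℝ × ℝ)) : Set (ℝ × ℝ)) := fun I ha hb =>
    convex_convexHull ℝ _ (subset_convexHull ℝ _ ha) (subset_convexHull ℝ _ hb)
      (uniformCdf_nonneg _) (sub_nonneg.2 (uniformCdf_le_one _)) (by ring)
  obtain ⟨i₀, -, hi₀⟩ := Finset.mem_image.1 hab.1
  have hn : (n : ℝ) ≠ 0 := by exact_mod_cast (Fin.pos i₀).ne'
  have hsum : ∑ i, ((x i).1 - m) = 0 := by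
    rw [hm, hA, avgReceiver_image hx]
    simp
    field_simp
    ring
  set D := ∑ i, max (m - (x i).1) 0 with hD
  have hDP : ∑ i, max ((x i).1 - m) 0 = D := by
    have : ∑ i, max ((x i).1 - m) 0 = ∑ i, (((x i).1 - m) + max (m - (x i).1) 0) := by
      refine Finset.sum_congr rfl fun i _ => ?_
      rcases le_total m (x i).1 with h | h
      · rw [max_eq_left (by linarith), max_eq_right (by linarith), add_zero]
      · rw [max_eq_right (by linarith), max_eq_left (by linarith)]
        ring
    rw [this, Finset.sum_add_distrib, hsum, zero_add]
  have hD0 : 0 ≤ D := Finset.sum_nonneg fun i _ => le_max_right _ _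
  -- If `D = 0`, all receiver values equal `m`, and `P` itself is admissible for every `I`
  -- containing the pair.
  rcases hD0.eq_or_lt with hDz | hDpos
  · have hρ : ∀ i, (x i).1 = m := by
      intro i
      have h1 := (Finset.sum_eq_zero_iff_of_nonneg fun i _ => le_max_right _ _).1 hDz.symm i
        (Finset.mem_univ i)
      have h2 := (Finset.sum_eq_zero_iff_of_nonneg fun i _ => le_max_right _ _).1
        (hDP.trans hDz.symm) i (Finset.mem_univ i)
      have h3 := le_max_left (m - (x i).1) 0
      have h4 := le_max_left ((x i).1 - m) 0
      linarith
    refine ⟨Pi.single i₀ 1, fun i => ?_, by simp, ?_⟩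
    · by_cases h : i = i₀
      · subst h
        simp
      · simp [h]
    · intro I ha hb a' b' hab'
      have hI : (I.card : ℝ) ≠ 0 := by
        have : I.Nonempty := Finset.image_nonempty.1 ⟨a, ha⟩
        exact_mod_cast this.card_pos.ne'
      have h1 := hab'.snd_le (hPI I ha hb) (by
        rw [avgReceiver_image hx, Finset.sum_congr rfl fun i _ => hρ i, Finset.sum_const,
          nsmul_eq_mul, mul_div_cancel_left₀ _ hI]
        exact hP1)
      refine le_trans (mul_le_of_le_one_left hP2 ?_) h1
      simp only [Pi.single_apply, Finset.sum_ite_eq']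
      split_ifs <;> norm_num
  · refine ⟨fun i => max (m - (x i).1) 0 / D, fun i => div_nonneg (le_max_right _ _) hD0, ?_, ?_⟩
    · rw [← Finset.sum_div, div_self hDpos.ne']
    · intro I ha hb a' b' hab'
      have hIne : I.Nonempty := Finset.image_nonempty.1 ⟨a, ha⟩
      have hIpos : (0 : ℝ) < I.card := by exact_mod_cast hIne.card_pos
      -- The comparison point is `w • P + (1 - w) • x e`, where `x e` has the best receiver value in
      -- `I` and makes up for the part of the average not covered by `w * m`.
      obtain ⟨e, heI, hemax⟩ := I.exists_max_image (fun i => (x i).1) hIne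
      set w := ∑ i ∈ I, max (m - (x i).1) 0 / D with hw
      have hw0 : 0 ≤ w := Finset.sum_nonneg fun i _ => div_nonneg (le_max_right _ _) hD0
      have hwD : w * D = ∑ i ∈ I, max (m - (x i).1) 0 := by
        rw [hw, ← Finset.sum_div, div_mul_cancel₀ _ hDpos.ne']
      have hsubset : ∀ f : Fin n → ℝ, (∀ i, 0 ≤ f i) → ∑ i ∈ I, f i ≤ ∑ i, f i := fun f hf =>
        Finset.sum_le_sum_of_subset_of_nonneg (Finset.subset_univ I) fun i _ _ => hf i
      have hw1 : w ≤ 1 := by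
        have h1 : w * D ≤ D := by
          rw [hwD]
          exact hsubset _ fun i => le_max_right _ _
        by_contra! hlt
        nlinarith
      have hq : w • P + (1 - w) • x e ∈
          convexHull ℝ ((I.image x : Finset (ℝ × ℝ)) : Set (ℝ × ℝ)) :=
        convex_convexHull ℝ _ (hPI I ha hb)
          (subset_convexHull ℝ _ (Finset.mem_coe.2 (Finset.mem_image_of_mem x heI)))
          hw0 (sub_nonneg.2 hw1) (by ring)
      have h1 := hab'.snd_le hq (by
        rw [avgReceiver_image hx, div_le_iff₀ hIpos]
        simp only [Prod.fst_add, Prod.smul_fst, smul_eq_mul]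
        have hle : w * m + (1 - w) * (x e).1 ≤ w * P.1 + (1 - w) * (x e).1 := by
          gcongr
        refine le_trans ?_ (mul_le_mul_of_nonneg_right hle hIpos.le)
        rcases le_total m (x e).1 with hme | hme
        · have hpos : ∑ i ∈ I, max ((x i).1 - m) 0 ≤ I.card * ((x e).1 - m) := by
            rw [← nsmul_eq_mul, ← Finset.sum_const]
            exact Finset.sum_le_sum fun i hi =>
              max_le (sub_le_sub_right (hemax i hi) m) (sub_nonneg.2 hme)
          have hposD : ∑ i ∈ I, max ((x i).1 - m) 0 ≤ D := by
            rw [← hDP]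
            exact hsubset _ fun i => le_max_right _ _
          have hdiff : ∑ i ∈ I, (x i).1 =
              I.card * m + ∑ i ∈ I, max ((x i).1 - m) 0 - w * D := by
            rw [hwD, ← nsmul_eq_mul, ← Finset.sum_const, ← Finset.sum_add_distrib,
              ← Finset.sum_sub_distrib]
            refine Finset.sum_congr rfl fun i _ => ?_
            rcases le_total m (x i).1 with h | h
            · rw [max_eq_left (by linarith), max_eq_right (by linarith)]
              ring
            · rw [max_eq_right (by linarith), max_eq_left (by linarith)]
              ring
          -- The surplus of `I` is split into shares `w` and `1 - w`: the first is at most `w * D`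
          -- and cancels the shortfall, the second is at most `(1 - w) * |I| * ((x e).1 - m)`.
          have h2 := mul_le_mul_of_nonneg_left hposD hw0
          have h3 := mul_le_mul_of_nonneg_left hpos (sub_nonneg.2 hw1)
          rw [hdiff]
          linarith
        · have h2 : ∑ i ∈ I, (x i).1 ≤ I.card * (x e).1 := by
            rw [← nsmul_eq_mul, ← Finset.sum_const]
            exact Finset.sum_le_sum fun i hi => hemax i hi
          have h3 := mul_le_mul_of_nonneg_left hme hw0
          nlinarith)
      refine le_trans ?_ h1
      simp only [Prod.snd_add, Prod.smul_snd, smul_eq_mul]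
      exact le_add_of_nonneg_right (mul_nonneg (sub_nonneg.2 hw1) (hξ e))

end Subsets

/-! ### The sender's value for a general sample size -/

section SenderValue

open scoped Classical

variable {n : ℕ} {x : Fin n → ℝ × ℝ} {sel : Finset (ℝ × ℝ) → (ℝ × ℝ) × (ℝ × ℝ)}

/-- The expected value of the Pareto procedure on a random sample. -/
theorem le_choose_mul_sum_paretoPoint (hn : 3 ≤ n) (hsel : IsParetoRule sel)
    (hx : Function.Injective x) (hξ : ∀ i, 0 ≤ (x i).2) {a b : ℝ × ℝ}
    (hab : IsParetoPair (Finset.univ.image x) a b) (t : Fin n) :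
    (n.factorial : ℝ) * (((t : ℕ) + 1).choose 3 : ℝ) *
        (paretoPoint (Finset.univ.image x) a b).2 ≤
      (n.choose 3 : ℝ) *
        ∑ π, (paretoPoint (seen x π t) (sel (seen x π t)).1 (sel (seen x π t)).2).2 := by
  obtain ⟨c, hc0, hc1, hc⟩ := exists_weights hx hξ hab
  obtain ⟨i, -, rfl⟩ := Finset.mem_image.1 hab.1
  obtain ⟨j, -, rfl⟩ := Finset.mem_image.1 hab.2.1
  set V := (paretoPoint (Finset.univ.image x) (x i) (x j)).2 with hV
  have hV0 : 0 ≤ V := by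
    refine paretoPoint_snd_nonneg (fun c hc => ?_) hab.1 hab.2.1
    obtain ⟨i, -, rfl⟩ := Finset.mem_image.1 hc
    exact hξ i
  have himg : ∀ π : Order n, seen x π t = ((Finset.Iic t).image π).image x := fun π => by
    rw [Finset.image_image]
    rfl
  -- Summing over `l` with weights `c l` turns the share of shortfall in the sample into the
  -- probability that a random third candidate is early; if `i` or `j` is missing, the left side is
  -- zero.
  have hpt : ∀ π : Order n,
      ∑ l, c l * (if ({i, j, l} : Finset (Fin n)) ⊆ (Finset.Iic t).image π then 1 else 0) * V ≤
        (paretoPoint (seen x π t) (sel (seen x π t)).1 (sel (seen x π t)).2).2 := by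
    intro π
    have hp := hsel.isParetoPair (seen_nonempty x π t)
    by_cases hij : i ∈ (Finset.Iic t).image π ∧ j ∈ (Finset.Iic t).image π
    · have h1 := hc ((Finset.Iic t).image π) (Finset.mem_image_of_mem x hij.1)
        (Finset.mem_image_of_mem x hij.2) (sel (seen x π t)).1 (sel (seen x π t)).2
        (by rw [← himg]; exact hp)
      rw [← himg] at h1
      refine le_trans (le_of_eq ?_) h1
      rw [← Finset.sum_mul]
      congr 1
      simp only [Finset.insert_subset_iff, Finset.singleton_subset_iff, hij.1, hij.2, true_and,
        mul_ite, mul_one, mul_zero]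
      rw [Finset.sum_ite_mem, Finset.univ_inter]
    · have h0 : ∀ l, ¬ ({i, j, l} : Finset (Fin n)) ⊆ (Finset.Iic t).image π := by
        intro l hl
        simp only [Finset.insert_subset_iff] at hl
        exact hij ⟨hl.1, hl.2.1⟩
      simp only [h0, if_false, mul_zero, zero_mul, Finset.sum_const_zero]
      refine paretoPoint_snd_nonneg (fun c hc => ?_) hp.1 hp.2.1
      obtain ⟨i, -, rfl⟩ := Finset.mem_image.1 hc
      exact hξ _
  have hsum := Finset.sum_le_sum fun π (_ : π ∈ (Finset.univ : Finset (Order n))) => hpt π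
  refine le_trans ?_ (mul_le_mul_of_nonneg_left hsum (Nat.cast_nonneg _))
  rw [Finset.sum_comm]
  have hnum : ∀ l, ∑ π : Order n,
      c l * (if ({i, j, l} : Finset (Fin n)) ⊆ (Finset.Iic t).image π then 1 else 0) * V =
        c l * (numEarly t {i, j, l} : ℝ) * V := by
    intro l
    rw [← Finset.sum_mul, ← Finset.mul_sum, numEarly, Finset.card_filter]
    push_cast
    rfl
  rw [Finset.sum_congr rfl fun l _ => hnum l, ← Finset.sum_mul, ← mul_assoc]
  refine mul_le_mul_of_nonneg_right ?_ hV0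
  rw [Finset.mul_sum]
  calc (n.factorial : ℝ) * (((t : ℕ) + 1).choose 3 : ℝ)
      = ∑ l, c l * ((n.factorial : ℝ) * (((t : ℕ) + 1).choose 3 : ℝ)) := by
        rw [← Finset.sum_mul, hc1, one_mul]
    _ ≤ ∑ l, (n.choose 3 : ℝ) * (c l * (numEarly t {i, j, l} : ℝ)) := by
        refine Finset.sum_le_sum fun l _ => ?_
        rw [mul_left_comm (n.choose 3 : ℝ)]
        refine mul_le_mul_of_nonneg_left ?_ (hc0 l)
        exact_mod_cast le_choose_mul_numEarly hn t i j l

theorem cast_choose_three (m : ℕ) :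
    ((m + 1).choose 3 : ℝ) = ((m : ℝ) + 1) * m * ((m : ℝ) - 1) / 6 := by
  induction m with
  | zero => simp [Nat.choose]
  | succ m ih =>
    rw [Nat.choose_succ_succ, Nat.cast_add, ih, Nat.cast_choose_two]
    push_cast
    ring

/-- The competitive ratio of the Growing Pareto mechanism with sample size `s`. -/
noncomputable def ratio (n s : ℕ) : ℝ :=
  (s : ℝ) * (((n : ℝ) - 2) * ((n : ℝ) - 3) - ((s : ℝ) - 1) * ((s : ℝ) - 2)) /
    (2 * n * ((n : ℝ) - 1) * ((n : ℝ) - 2))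

theorem sum_Ico_sub_one {s m : ℕ} (h : s ≤ m) :
    ∑ r ∈ Finset.Ico s m, ((r : ℝ) - 1) =
      (((m : ℝ) - 1) * ((m : ℝ) - 2) - ((s : ℝ) - 1) * ((s : ℝ) - 2)) / 2 := by
  induction m, h using Nat.le_induction with
  | base => simp
  | succ m hm ih =>
    rw [Finset.sum_Ico_succ_top hm, ih]
    push_cast
    ring

theorem ratio_eq_sum {n s : ℕ} (hn : 3 ≤ n) (hs : s < n) :
    ratio n s = ∑ r ∈ Finset.Ico s (n - 1), (s : ℝ) * ((r : ℝ) - 1) /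
      (n * ((n : ℝ) - 1) * ((n : ℝ) - 2)) := by
  have h3 : (3 : ℝ) ≤ n := by exact_mod_cast hn
  rw [← Finset.sum_div, ← Finset.mul_sum, sum_Ico_sub_one (by omega), ratio,
    Nat.cast_sub (by omega)]
  have h1 : (n : ℝ) - 1 ≠ 0 := by linarith
  have h2 : (n : ℝ) - 2 ≠ 0 := by linarith
  have h0 : (n : ℝ) ≠ 0 := by linarith
  push_cast
  field_simp
  ring

theorem ratio_nonneg {n s : ℕ} (hn : 3 ≤ n) (hs : s < n) (hs1 : 1 ≤ s) : 0 ≤ ratio n s := by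
  rw [ratio_eq_sum hn hs]
  have h3 : (3 : ℝ) ≤ n := by exact_mod_cast hn
  refine Finset.sum_nonneg fun r hr => ?_
  have hr1 : (1 : ℝ) ≤ r := by exact_mod_cast hs1.trans (Finset.mem_Ico.1 hr).1
  refine div_nonneg (mul_nonneg (Nat.cast_nonneg _) (by linarith)) ?_
  exact mul_nonneg (mul_nonneg (by linarith) (by linarith)) (by linarith)

/-- Round `r` contributes at least `s / r * 1 / (r + 1) * C(r+1,3) / C(n,3) = s (r - 1) / (n (n - 1)
(n - 2))` times the full value. The last round is only bounded below by zero, so the sum runs over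
`s ≤ r < n - 1`. -/
theorem ratio_mul_le_senderUtility {ρ ξ : Fin n → ℝ} {s : ℕ} (hn : 3 ≤ n) (hs1 : 1 ≤ s)
    (hs : s < n) (hsel : IsParetoRule sel) (hξ : ∀ i, 0 ≤ ξ i)
    (hx : Function.Injective fun i => (ρ i, ξ i)) {a b : ℝ × ℝ}
    (hab : IsParetoPair (Finset.univ.image fun i => (ρ i, ξ i)) a b) :
    ratio n s * (paretoPoint (Finset.univ.image fun i => (ρ i, ξ i)) a b).2 ≤
      senderUtility ρ ξ (growingPareto sel n s) := by
  set V := (paretoPoint (Finset.univ.image fun i => (ρ i, ξ i)) a b).2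
  have hfac : (0 : ℝ) < n.factorial := by exact_mod_cast n.factorial_pos
  have h3 : (3 : ℝ) ≤ n := by exact_mod_cast hn
  have hn0 : (n : ℝ) ≠ 0 := by linarith
  have hn1 : (n : ℝ) - 1 ≠ 0 := by linarith
  have hn2 : (n : ℝ) - 2 ≠ 0 := by linarith
  have hnpos : (0 : ℝ) < n * ((n : ℝ) - 1) * ((n : ℝ) - 2) :=
    mul_pos (mul_pos (by linarith) (by linarith)) (by linarith)
  rw [senderUtility_growingPareto s (by omega), le_div_iff₀ hfac, ratio_eq_sum hn hs]
  let f : ℕ → ℝ := fun r => (s : ℝ) * ((r : ℝ) - 1) / (n * ((n : ℝ) - 1) * ((n : ℝ) - 2)) *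
    V * n.factorial
  have hround : ∀ r : Fin n, (if (r : ℕ) ∈ Finset.Ico s (n - 1) then f r else 0) ≤
      ∑ π, hireWeight sel s (fun i => (ρ i, ξ i)) π r * ξ (π r) := by
    intro r
    split_ifs with hr
    · obtain ⟨hsr, hrn⟩ := Finset.mem_Ico.1 hr
      have hrpos : (0 : ℝ) < r := by exact_mod_cast hs1.trans hsr
      have h1 := sum_hireWeight_mul_self s hsel hx (r := r) hsr (by omega) fun p => p.2
      have h2 : ∀ π : Order n, _ = _ := fun π =>
        have hp := hsel.isParetoPair (seen_nonempty (fun i => (ρ i, ξ i)) π r)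
        sum_paretoProb_mul_snd hp.1 hp.2.1
      have h4 := le_choose_mul_sum_paretoPoint hn hsel hx hξ hab r
      rw [h1, Finset.sum_congr rfl fun π _ => h2 π, survival_of_le hs1 hsr]
      have hnn : (n.choose 3 : ℝ) = n * ((n : ℝ) - 1) * ((n : ℝ) - 2) / 6 := by
        obtain ⟨m, rfl⟩ : ∃ m, n = m + 1 := ⟨n - 1, by omega⟩
        rw [cast_choose_three]
        push_cast
        ring
      rw [cast_choose_three, hnn] at h4
      set Y := ∑ π, (paretoPoint (seen (fun i => (ρ i, ξ i)) π r)
        (sel (seen (fun i => (ρ i, ξ i)) π r)).1 (sel (seen (fun i => (ρ i, ξ i)) π r)).2).2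
      have h5 : (n.factorial : ℝ) * (((r : ℝ) + 1) * r * ((r : ℝ) - 1)) * V /
          (n * ((n : ℝ) - 1) * ((n : ℝ) - 2)) ≤ Y := by
        rw [div_le_iff₀ hnpos]
        linarith
      refine le_trans (le_of_eq ?_) (mul_le_mul_of_nonneg_left h5
        (by positivity : (0 : ℝ) ≤ (s : ℝ) / r / ((r : ℝ) + 1)))
      simp only [f]
      field_simp
    · exact Finset.sum_nonneg fun π _ => mul_nonneg (hireWeight_nonneg s sel _ π r) (hξ _)
  refine le_trans (le_of_eq ?_) (Finset.sum_le_sum fun r _ => hround r)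
  rw [Fin.sum_univ_eq_sum_range (fun r => if r ∈ Finset.Ico s (n - 1) then f r else 0),
    Finset.sum_ite_mem, Finset.inter_eq_right.2, Finset.sum_mul, Finset.sum_mul]
  intro r hr
  have := (Finset.mem_Ico.1 hr).2
  exact Finset.mem_range.2 (by omega)

theorem senderUtility_growingPareto_nonneg {ρ ξ : Fin n → ℝ} {s : ℕ} (hn : 1 ≤ n)
    (hξ : ∀ i, 0 ≤ ξ i) : 0 ≤ senderUtility ρ ξ (growingPareto sel n s) := by
  rw [senderUtility_growingPareto s hn]
  exact div_nonneg (Finset.sum_nonneg fun r _ => Finset.sum_nonneg fun π _ =>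
    mul_nonneg (hireWeight_nonneg s sel _ π r) (hξ _)) (Nat.cast_nonneg _)

end SenderValue

/-! ### The limit of the ratio -/

section Asymptotics

/-- With `y = s / n → 1 / √3`, the ratio tends to `y (1 - y²) / 2`. -/
theorem tendsto_ratio :
    Tendsto (fun n : ℕ => ratio n ⌊(n : ℝ) / √3⌋₊) atTop (𝓝 (1 / (3 * √3))) := by
  have hy : Tendsto (fun n : ℕ => (⌊(n : ℝ) / √3⌋₊ : ℝ) / n) atTop (𝓝 (1 / √3)) := by
    have h := (tendsto_nat_floor_mul_div_atTop (R := ℝ) (a := 1 / √3) (by positivity)).comp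
      tendsto_natCast_atTop_atTop
    refine h.congr fun n => ?_
    simp [div_eq_inv_mul]
  have hu : Tendsto (fun n : ℕ => (1 : ℝ) / n) atTop (𝓝 0) := tendsto_one_div_atTop_nhds_zero_nat
  have hlim : Tendsto (fun n : ℕ => (⌊(n : ℝ) / √3⌋₊ : ℝ) / n *
      ((1 - 2 * ((1 : ℝ) / n)) * (1 - 3 * ((1 : ℝ) / n)) -
        ((⌊(n : ℝ) / √3⌋₊ : ℝ) / n - (1 : ℝ) / n) *
          ((⌊(n : ℝ) / √3⌋₊ : ℝ) / n - 2 * ((1 : ℝ) / n))) /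
      (2 * (1 - (1 : ℝ) / n) * (1 - 2 * ((1 : ℝ) / n)))) atTop
      (𝓝 (1 / √3 * ((1 - 2 * 0) * (1 - 3 * 0) - (1 / √3 - 0) * (1 / √3 - 2 * 0)) /
        (2 * (1 - 0) * (1 - 2 * 0)))) := by
    have h1 := tendsto_const_nhds (x := (1 : ℝ)).sub hu
    have h2 := tendsto_const_nhds (x := (1 : ℝ)).sub (hu.const_mul 2)
    have h3 := tendsto_const_nhds (x := (1 : ℝ)).sub (hu.const_mul 3)
    exact (hy.mul ((h2.mul h3).sub ((hy.sub hu).mul (hy.sub (hu.const_mul 2))))).div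
      ((h1.const_mul 2).mul h2) (by norm_num)
  have hval : 1 / √3 * ((1 - 2 * 0) * (1 - 3 * 0) - (1 / √3 - 0) * (1 / √3 - 2 * 0)) /
      (2 * (1 - 0) * (1 - 2 * 0)) = 1 / (3 * √3) := by
    have h3 : √3 ^ 2 = 3 := Real.sq_sqrt (by norm_num)
    have h0 : √3 ≠ 0 := by positivity
    field_simp
    rw [h3]
    norm_num
  rw [hval] at hlim
  refine hlim.congr' ?_
  filter_upwards [eventually_ge_atTop 3] with n hn
  have h3 : (3 : ℝ) ≤ n := by exact_mod_cast hn
  have hn0 : (n : ℝ) ≠ 0 := by linarith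
  have hn1 : (n : ℝ) - 1 ≠ 0 := by linarith
  have hn2 : (n : ℝ) - 2 ≠ 0 := by linarith
  rw [ratio]
  field_simp

end Asymptotics

end SecretaryPersuasion

/-! ### The main theorem -/

theorem mainTheorem2 :
    ∃ ε : ℕ → ℝ, Tendsto ε atTop (𝓝 0) ∧
      ∀ (sel : Finset (ℝ × ℝ) → (ℝ × ℝ) × (ℝ × ℝ)), SecretaryPersuasion.IsParetoRule sel →
      ∀ (n : ℕ), 1 ≤ n → ∀ (ρ ξ : Fin n → ℝ),
        (∀ i, 0 ≤ ρ i) → (∀ i, 0 ≤ ξ i) → Function.Injective (fun i => (ρ i, ξ i)) →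
          SecretaryPersuasion.Persuasive ρ ξ
            (SecretaryPersuasion.growingPareto sel n ⌊(n : ℝ) / √3⌋₊) ∧
          (1 / (3 * √3) - ε n) * SecretaryPersuasion.OPT ρ ξ ≤
            SecretaryPersuasion.senderUtility ρ ξ
              (SecretaryPersuasion.growingPareto sel n ⌊(n : ℝ) / √3⌋₊) := by
  classical
  -- The error makes the guaranteed factor exactly `ratio`, or zero for `n < 3`, where three
  -- distinct candidates are not available.
  refine ⟨fun n => 1 / (3 * √3) - if 3 ≤ n then
    SecretaryPersuasion.ratio n ⌊(n : ℝ) / √3⌋₊ else 0, ?_, ?_⟩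
  · rw [← sub_self (1 / (3 * √3))]
    refine tendsto_const_nhds.sub (SecretaryPersuasion.tendsto_ratio.congr' ?_)
    filter_upwards [eventually_ge_atTop 3] with n hn
    rw [if_pos hn]
  intro sel hsel n hn ρ ξ hρ hξ hx
  refine ⟨SecretaryPersuasion.persuasive_growingPareto _ hsel hn hρ hx, ?_⟩
  rw [sub_sub_cancel]
  split_ifs with h3
  · have hne : (Finset.univ.image fun i => (ρ i, ξ i)).Nonempty :=
      ⟨_, Finset.mem_image_of_mem _ (Finset.mem_univ (⟨0, hn⟩ : Fin n))⟩
    obtain ⟨a, b, hab⟩ := SecretaryPersuasion.exists_isParetoPair hne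
    have h3' : (3 : ℝ) ≤ n := by exact_mod_cast h3
    have hsqrt1 : 1 < √3 := by
      rw [Real.lt_sqrt] <;> norm_num
    have hsqrt3 : √3 ≤ 3 := by
      rw [Real.sqrt_le_left] <;> norm_num
    have hs1 : 1 ≤ ⌊(n : ℝ) / √3⌋₊ := by
      rw [Nat.one_le_floor_iff, le_div_iff₀ (by linarith)]
      linarith
    have hs : ⌊(n : ℝ) / √3⌋₊ < n := by
      rw [Nat.floor_lt (by positivity)]
      exact div_lt_self (by linarith) hsqrt1
    have hopt := SecretaryPersuasion.OPT_le hn hρ hξ hx hab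
    exact (mul_le_mul_of_nonneg_left hopt (SecretaryPersuasion.ratio_nonneg h3 hs hs1)).trans
      (SecretaryPersuasion.ratio_mul_le_senderUtility h3 hs1 hs hsel hξ hx hab)
  · rw [zero_mul]
    exact SecretaryPersuasion.senderUtility_growingPareto_nonneg hn hξ
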